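/- Let $K\subset\mathbb C$ be a convex compact set with non-empty interior, $\Gamma=\partial K$, and $\Omega_K=\overline{\mathbb C}\setminus K$, where $\overline{\mathbb C}$ is the Riemann sphere. Let $\mathsf E^2(\Omega_K)$ be the Smirnov space, that is, the closure in $\mathsf L^2(\Gamma)$ (with respect to the length measure $|{\rm d}w|$) of the functions analytic in $\Omega_K$, continuous up to the boundary, and vanishing at infinity. An element $f$ of $\mathsf E^2(\Omega_K)$ is regarded as a function on $\Gamma$ (up to a set of length zero) together with a function analytic in $\Omega_K$: if such functions $f_n$ converge to $f$ in $\mathsf L^2(\Gamma)$, they converge to $f$ locally uniformly in $\mathbb C\setminus K$. Then there is a constant $C(\Gamma)<\infty$, depending only on $\Gamma$, such that for every supporting line $\ell$ to $\Gamma$ (a line that meets $\Gamma$ and has $\Gamma$ on one side of it, touching allowed) and every $f\in\mathsf E^2(\Omega_K)$, \[ \int_\ell |f|^2\,|{\rm d}w| \le C(\Gamma)\int_\Gamma |f|^2\,|{\rm d}w| . \] -/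

import Mathlib

open MeasureTheory Filter Topology
open scoped NNReal ENNReal

/-- The length measure `|dw|` on a subset `S` of the plane: one-dimensional Hausdorff measure
restricted to `S`. -/
noncomputable def arcLength (S : Set ℂ) : Measure ℂ := (Measure.hausdorffMeasure 1).restrict S

/-- Functions analytic in the complement of `K`, continuous up to the boundary, and vanishing at
infinity (hence analytic at infinity as well, by the removable singularity theorem). -/
structure IsRegularOutside (K : Set ℂ) (F : ℂ → ℂ) : Prop where
  differentiableOn : DifferentiableOn ℂ F Kᶜ
  continuousOn : ContinuousOn F (closure Kᶜ)
  tendsto_zero : Tendsto F (cocompact ℂ) (𝓝 0)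

/-- `f` belongs to the Smirnov space `E²` of the complement of `K` in the Riemann sphere, that is,
to the closure in `L²(Γ)`, `Γ = ∂K`, of the functions in `IsRegularOutside K`. An element is
represented by one function `f` on the plane: its restriction to `Γ` is (a representative of) the
`L²(Γ)`-limit of a sequence of regular functions, and its restriction to `Kᶜ` is the limit of the
same sequence inside the domain, which is analytic there. The values of `f` inside `K` are
irrelevant. -/
structure MemSmirnovTwo (K : Set ℂ) (f : ℂ → ℂ) : Prop where
  memLp : MemLp f 2 (arcLength (frontier K))
  exists_approx : ∃ F : ℕ → ℂ → ℂ, (∀ n, IsRegularOutside K (F n)) ∧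
    Tendsto (fun n => eLpNorm (F n - f) 2 (arcLength (frontier K))) atTop (𝓝 0) ∧
    TendstoLocallyUniformlyOn F f atTop Kᶜ

/-- `l` is a supporting line to `S`: a line through a point `a` of `S`, with normal vector `u`, such
that `S` lies in one of the two closed half-planes bounded by `l`. -/
def IsSupportingLine (S l : Set ℂ) : Prop :=
  ∃ a u : ℂ, a ∈ S ∧ u ≠ 0 ∧ l = {w | inner ℝ u w = inner ℝ u a} ∧
    ∀ z ∈ S, inner ℝ u z ≤ inner ℝ u a

/-! The proof is a reflection argument combined with a Carleson embedding. After a rigid motion the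
line is horizontal, `K` lies below it and the origin is interior to `K`. First let the line `ℓ` have
height `β` strictly above `K` and let `F` be regular outside `K`. Write `w*` for the mirror image of
`w` in `ℓ`.

On `ℓ` one has `w = w*`, so `|F|²` is the restriction of `F(w) * conj F(w*)`. This function is
analytic below `ℓ` off `K` and is `O(|w|⁻²)`. Moving the contour from `ℓ` to `Γ` gives `∫_ℓ |F|² ≤
∫_Γ |F(w)| |F(w*)| |dw|` (`IsPolygonAround.sum_segIntegral_mul_reflect`,
`ofReal_integral_line_sq_le`). Formally, the contour is moved by two Cauchy formulas, one around `K`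
and one in the half-plane, joined by Fubini. `Γ` is reached as a limit of polygons around `K`.

By Cauchy–Schwarz the right side is at most `‖F‖_Γ * ‖F‖_{Γ*}`, where `Γ*` is the mirror image of
`Γ`, above `ℓ`. There `F` is the Poisson integral of its values on `ℓ`, and arc length on a convex
curve is a Carleson measure with an absolute constant, so `‖F‖²_{Γ*} ≤ 512 ‖F‖²_ℓ`
(`lintegral_reflect_sq_le`). Cancelling one finite factor `‖F‖²_ℓ` leaves `‖F‖²_ℓ ≤ 512 ‖F‖²_Γ`.

The embedding is proved in dual form, as an `L²` bound for the balayage of a density on `Γ*` to `ℓ`.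
`Γ` is cut into four pieces that are graphs of slope at most one over a coordinate axis. Over the
horizontal axis a quasi-metric property of the Poisson kernel suffices; over the vertical axis the
bound is Schur's test for the kernel `1/(y + y')`.

Fatou's lemma then lets `ℓ` descend to the supporting line, and passes from regular functions to
`E²`. -/

/-! ### The Poisson kernel and products of two such kernels -/

/-- The Poisson kernel of the upper half-plane at height `y` and horizontal offset `u`. -/
noncomputable def poissonHalfPlane (y u : ℝ) : ℝ := y / (Real.pi * (u ^ 2 + y ^ 2))

theorem poissonHalfPlane_nonneg {y : ℝ} (hy : 0 ≤ y) (u : ℝ) : 0 ≤ poissonHalfPlane y u := by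
  unfold poissonHalfPlane; positivity

theorem poissonHalfPlane_eq_cauchyPDFReal {y : ℝ} (hy : 0 < y) (x t : ℝ) :
    poissonHalfPlane y (x - t) = ProbabilityTheory.cauchyPDFReal x y.toNNReal t := by
  rw [ProbabilityTheory.cauchyPDFReal_def, poissonHalfPlane, Real.coe_toNNReal y hy.le]
  have : (t - x) ^ 2 + y ^ 2 ≠ 0 := by positivity
  have h2 : (x - t) ^ 2 + y ^ 2 ≠ 0 := by positivity
  have := Real.pi_ne_zero
  field_simp
  ring

theorem lintegral_poissonHalfPlane {y : ℝ} (hy : 0 < y) (x : ℝ) :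
    ∫⁻ t, ENNReal.ofReal (poissonHalfPlane y (x - t)) = 1 := by
  simp_rw [poissonHalfPlane_eq_cauchyPDFReal hy]
  exact ProbabilityTheory.lintegral_cauchyPDF_eq_one x (by simpa using hy)

theorem integrable_poissonHalfPlane {y : ℝ} (hy : 0 < y) (x : ℝ) :
    Integrable fun t => poissonHalfPlane y (x - t) := by
  simp_rw [poissonHalfPlane_eq_cauchyPDFReal hy]
  exact ProbabilityTheory.integrable_cauchyPDFReal x

theorem integral_poissonHalfPlane {y : ℝ} (hy : 0 < y) (x : ℝ) :
    ∫ t, poissonHalfPlane y (x - t) = 1 := by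
  simp_rw [poissonHalfPlane_eq_cauchyPDFReal hy]
  exact ProbabilityTheory.integral_cauchyPDFReal_eq_one x (by simpa using hy)

theorem poissonHalfPlane_le {y : ℝ} (hy : 0 < y) (u : ℝ) :
    poissonHalfPlane y u ≤ 1 / (Real.pi * y) := by
  have hp := Real.pi_pos
  unfold poissonHalfPlane
  rw [div_le_div_iff₀ (by positivity) (by positivity)]
  nlinarith [mul_nonneg hp.le (sq_nonneg u)]

theorem poissonHalfPlane_le_four_mul {y u v : ℝ} (hy : 0 < y) (h : |u| ≤ 2 * |v|) :
    poissonHalfPlane y v ≤ 4 * poissonHalfPlane y u := by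
  have hp := Real.pi_pos
  have h2 : u ^ 2 ≤ 4 * v ^ 2 := by
    have := mul_self_le_mul_self (abs_nonneg u) h
    rw [← sq_abs u, ← sq_abs v]; nlinarith
  unfold poissonHalfPlane
  rw [← mul_div_assoc, div_le_div_iff₀ (by positivity) (by positivity)]
  have : u ^ 2 + y ^ 2 ≤ 4 * (v ^ 2 + y ^ 2) := by nlinarith [sq_nonneg y]
  nlinarith [mul_le_mul_of_nonneg_left this (mul_pos hy hp).le]

/-- By the triangle inequality one of `|x - t|`, `|x' - t|` is at least `|x - x'| / 2`. Halving the
offset raises the kernel at most fourfold, so that factor can be replaced by its value at the offset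
between `x` and `x'`, which no longer depends on `t`. -/
theorem poissonHalfPlane_mul_le {y y' : ℝ} (hy : 0 < y) (hy' : 0 < y') (x x' t : ℝ) :
    poissonHalfPlane y (x - t) * poissonHalfPlane y' (x' - t) ≤
      4 * poissonHalfPlane y (x - x') * poissonHalfPlane y' (x' - t) +
        4 * poissonHalfPlane y' (x' - x) * poissonHalfPlane y (x - t) := by
  have n1 := poissonHalfPlane_nonneg hy.le
  have n2 := poissonHalfPlane_nonneg hy'.le
  have htri : |x - x'| ≤ |x - t| + |x' - t| := by
    rw [abs_sub_comm x' t]; exact abs_sub_le x t x'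
  rcases le_total |x' - t| |x - t| with h | h
  · have h1 := poissonHalfPlane_le_four_mul hy (u := x - x') (v := x - t) (by linarith)
    have := mul_le_mul_of_nonneg_right h1 (n2 (x' - t))
    have h3 := mul_nonneg (mul_nonneg zero_le_four (n2 (x' - x))) (n1 (x - t))
    linarith
  · rw [abs_sub_comm] at htri
    have h1 := poissonHalfPlane_le_four_mul hy' (u := x' - x) (v := x' - t) (by linarith)
    have := mul_le_mul_of_nonneg_left h1 (n1 (x - t))
    have h3 := mul_nonneg (mul_nonneg zero_le_four (n1 (x - x'))) (n2 (x' - t))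
    linarith

theorem lintegral_poissonHalfPlane_mul_le_add {y y' : ℝ} (hy : 0 < y) (hy' : 0 < y') (x x' : ℝ) :
    ∫⁻ t, ENNReal.ofReal (poissonHalfPlane y (x - t)) *
        ENNReal.ofReal (poissonHalfPlane y' (x' - t)) ≤
      4 * ENNReal.ofReal (poissonHalfPlane y (x - x')) +
        4 * ENNReal.ofReal (poissonHalfPlane y' (x' - x)) := by
  have n1 := poissonHalfPlane_nonneg hy.le
  have n2 := poissonHalfPlane_nonneg hy'.le
  have m : ∀ y x : ℝ, Measurable fun t => ENNReal.ofReal (poissonHalfPlane y (x - t)) := by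
    intro y x; unfold poissonHalfPlane; fun_prop
  calc _ ≤ ∫⁻ t, (4 * ENNReal.ofReal (poissonHalfPlane y (x - x')) *
          ENNReal.ofReal (poissonHalfPlane y' (x' - t)) +
        4 * ENNReal.ofReal (poissonHalfPlane y' (x' - x)) *
          ENNReal.ofReal (poissonHalfPlane y (x - t))) := by
        refine lintegral_mono fun t => ?_
        have h4 : (4 : ℝ≥0∞) = ENNReal.ofReal 4 := by simp
        have p4 : (0 : ℝ) ≤ 4 := by norm_num
        rw [h4, ← ENNReal.ofReal_mul (n1 _), ← ENNReal.ofReal_mul p4, ← ENNReal.ofReal_mul p4,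
          ← ENNReal.ofReal_mul (mul_nonneg p4 (n1 _)),
          ← ENNReal.ofReal_mul (mul_nonneg p4 (n2 _)),
          ← ENNReal.ofReal_add (mul_nonneg (mul_nonneg (by norm_num) (n1 _)) (n2 _))
            (mul_nonneg (mul_nonneg (by norm_num) (n2 _)) (n1 _))]
        exact ENNReal.ofReal_le_ofReal (poissonHalfPlane_mul_le hy hy' x x' t)
    _ = _ := by
        rw [lintegral_add_left ((m _ _).const_mul _), lintegral_const_mul _ (m _ _),
          lintegral_const_mul _ (m _ _), lintegral_poissonHalfPlane hy,
          lintegral_poissonHalfPlane hy', mul_one, mul_one]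

theorem lintegral_poissonHalfPlane_mul_le_left {y y' : ℝ} (hy : 0 < y) (hy' : 0 < y') (x x' : ℝ) :
    ∫⁻ t, ENNReal.ofReal (poissonHalfPlane y (x - t)) *
        ENNReal.ofReal (poissonHalfPlane y' (x' - t)) ≤ ENNReal.ofReal (1 / (Real.pi * y)) := by
  have m : ∀ y x : ℝ, Measurable fun t => ENNReal.ofReal (poissonHalfPlane y (x - t)) := by
    intro y x; unfold poissonHalfPlane; fun_prop
  calc _ ≤ ∫⁻ t, ENNReal.ofReal (1 / (Real.pi * y)) *
          ENNReal.ofReal (poissonHalfPlane y' (x' - t)) := by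
        gcongr with t; exact poissonHalfPlane_le hy _
    _ = _ := by rw [lintegral_const_mul _ (m _ _), lintegral_poissonHalfPlane hy', mul_one]

/-- The kernel with the larger height is bounded by `1 / (π max(y, y'))` and the other has mass one;
`π` exceeds `2`. -/
theorem lintegral_poissonHalfPlane_mul_le_inv {y y' : ℝ} (hy : 0 < y) (hy' : 0 < y') (x x' : ℝ) :
    ∫⁻ t, ENNReal.ofReal (poissonHalfPlane y (x - t)) *
        ENNReal.ofReal (poissonHalfPlane y' (x' - t)) ≤ ENNReal.ofReal (1 / (y + y')) := by
  have hp := Real.pi_gt_three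
  rcases le_total y y' with h | h
  · simp_rw [mul_comm (ENNReal.ofReal (poissonHalfPlane y _))]
    refine (lintegral_poissonHalfPlane_mul_le_left hy' hy x' x).trans (ENNReal.ofReal_le_ofReal ?_)
    apply one_div_le_one_div_of_le (by positivity); nlinarith
  · refine (lintegral_poissonHalfPlane_mul_le_left hy hy' x x').trans (ENNReal.ofReal_le_ofReal ?_)
    apply one_div_le_one_div_of_le (by positivity); nlinarith

/-! ### Cauchy–Schwarz and cancellation in `[0, ∞]` -/

theorem lintegral_mul_sq_le {α : Type*} [MeasurableSpace α] {μ : Measure α} {f g : α → ℝ≥0∞}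
    (hf : AEMeasurable f μ) (hg : AEMeasurable g μ) :
    (∫⁻ a, f a * g a ∂μ) ^ 2 ≤ (∫⁻ a, f a ^ 2 ∂μ) * ∫⁻ a, g a ^ 2 ∂μ := by
  have h := ENNReal.lintegral_mul_le_Lp_mul_Lq μ Real.HolderConjugate.two_two hf hg
  simp only [Pi.mul_apply, ENNReal.rpow_two] at h
  calc _ ≤ ((∫⁻ a, f a ^ 2 ∂μ) ^ (1 / 2 : ℝ) * (∫⁻ a, g a ^ 2 ∂μ) ^ (1 / 2 : ℝ)) ^ 2 := by
        gcongr
    _ = _ := by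
        rw [mul_pow, ← ENNReal.rpow_two, ← ENNReal.rpow_two, ← ENNReal.rpow_mul, ← ENNReal.rpow_mul]
        norm_num

theorem ENNReal.le_of_sq_le_mul {a b : ℝ≥0∞} (h : a ^ 2 ≤ b * a) (ha : a ≠ ∞) : a ≤ b := by
  rcases eq_or_ne a 0 with rfl | h0
  · simp
  · rw [sq] at h
    exact (ENNReal.mul_le_mul_iff_left h0 ha).1 h

theorem ENNReal.two_mul_le_sq_add_sq (a b : ℝ≥0∞) : 2 * a * b ≤ a ^ 2 + b ^ 2 := by
  wlog h : a ≤ b generalizing a b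
  · have := this b a (le_of_not_ge h)
    rwa [mul_right_comm, add_comm] at this
  · obtain ⟨d, rfl⟩ := exists_add_of_le h
    calc 2 * a * (a + d) ≤ 2 * a * (a + d) + d ^ 2 := le_self_add
      _ = _ := by ring

/-! ### Balayage to the line and its `L²` bounds -/

section Balayage

variable {X : Type*} [MeasurableSpace X] {μ : Measure X} [IsFiniteMeasure μ] {x y : X → ℝ}
  {g : X → ℝ≥0∞}

/-- The balayage onto the real line of the density `g` carried by points `x z + i y z` of the upper
half-plane. -/
noncomputable def balayage (μ : Measure X) (x y : X → ℝ) (g : X → ℝ≥0∞) (t : ℝ) : ℝ≥0∞ :=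
  ∫⁻ z, ENNReal.ofReal (poissonHalfPlane (y z) (x z - t)) * g z ∂μ

theorem measurable_poissonHalfPlane_comp (hx : Measurable x) (hy : Measurable y) :
    Measurable fun p : X × ℝ => ENNReal.ofReal (poissonHalfPlane (y p.1) (x p.1 - p.2)) := by
  unfold poissonHalfPlane; fun_prop

theorem measurable_balayage (hx : Measurable x) (hy : Measurable y) (hg : Measurable g) :
    Measurable (balayage μ x y g) := by
  unfold balayage
  exact Measurable.lintegral_prod_left'
    (f := fun p : X × ℝ => ENNReal.ofReal (poissonHalfPlane (y p.1) (x p.1 - p.2)) * g p.1)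
    ((measurable_poissonHalfPlane_comp hx hy).mul (hg.comp measurable_fst))

theorem lintegral_mul_balayage (hx : Measurable x) (hy : Measurable y) (hg : Measurable g)
    {f : ℝ → ℝ≥0∞} (hf : Measurable f) :
    ∫⁻ t, f t * balayage μ x y g t =
      ∫⁻ z, g z * (∫⁻ t, ENNReal.ofReal (poissonHalfPlane (y z) (x z - t)) * f t) ∂μ := by
  have mk := measurable_poissonHalfPlane_comp hx hy
  have mk1 : ∀ t : ℝ, Measurable fun z => ENNReal.ofReal (poissonHalfPlane (y z) (x z - t)) :=
    fun t => mk.comp measurable_prodMk_right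
  have mk2 : ∀ z : X, Measurable fun t => ENNReal.ofReal (poissonHalfPlane (y z) (x z - t)) :=
    fun z => mk.comp measurable_prodMk_left
  calc _ = ∫⁻ t, ∫⁻ z, f t * (ENNReal.ofReal (poissonHalfPlane (y z) (x z - t)) * g z) ∂μ := by
        refine lintegral_congr fun t => ?_
        exact (lintegral_const_mul _ ((mk1 t).mul hg)).symm
    _ = ∫⁻ z, (∫⁻ t, f t * (ENNReal.ofReal (poissonHalfPlane (y z) (x z - t)) * g z)) ∂μ := by
        refine lintegral_lintegral_swap (Measurable.aemeasurable ?_)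
        exact (hf.comp measurable_fst).mul
          ((mk.comp measurable_swap).mul (hg.comp measurable_snd))
    _ = _ := by
        refine lintegral_congr fun z => ?_
        refine Eq.trans ?_ (lintegral_const_mul _ ((mk2 z).mul hf))
        refine lintegral_congr fun t => by ring

theorem lintegral_balayage_sq (hx : Measurable x) (hy : Measurable y) (hg : Measurable g) :
    ∫⁻ t, balayage μ x y g t ^ 2 = ∫⁻ z, ∫⁻ w, g z * g w *
      (∫⁻ t, ENNReal.ofReal (poissonHalfPlane (y z) (x z - t)) *
        ENNReal.ofReal (poissonHalfPlane (y w) (x w - t))) ∂μ ∂μ := by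
  have mk := measurable_poissonHalfPlane_comp hx hy
  have mk2 : ∀ z : X, Measurable fun t => ENNReal.ofReal (poissonHalfPlane (y z) (x z - t)) :=
    fun z => mk.comp measurable_prodMk_left
  have mN : ∀ z : X, Measurable fun w =>
      ∫⁻ t, ENNReal.ofReal (poissonHalfPlane (y z) (x z - t)) *
        ENNReal.ofReal (poissonHalfPlane (y w) (x w - t)) := by
    intro z
    exact Measurable.lintegral_prod_right' (f := fun p : X × ℝ =>
      ENNReal.ofReal (poissonHalfPlane (y z) (x z - p.2)) *
        ENNReal.ofReal (poissonHalfPlane (y p.1) (x p.1 - p.2)))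
      (((mk2 z).comp measurable_snd).mul mk)
  simp_rw [sq]
  rw [lintegral_mul_balayage hx hy hg (measurable_balayage hx hy hg)]
  refine lintegral_congr fun z => ?_
  rw [lintegral_mul_balayage hx hy hg (mk2 z)]
  simp_rw [mul_comm _ (ENNReal.ofReal (poissonHalfPlane (y z) _))]
  refine (lintegral_const_mul (μ := μ) (g z) (hg.mul (mN z))).symm.trans ?_
  refine lintegral_congr fun w => ?_
  simp only [Pi.mul_apply]
  rw [mul_assoc]

/-- A purely qualitative bound, used to justify dividing by this integral. Heights bounded away from
zero make the kernels bounded. -/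
theorem lintegral_balayage_sq_lt_top (hx : Measurable x) (hy : Measurable y) (hg : Measurable g)
    {ε : ℝ} (hε : 0 < ε) (hyε : ∀ z, ε ≤ y z) (hg2 : ∫⁻ z, g z ^ 2 ∂μ < ∞) :
    ∫⁻ t, balayage μ x y g t ^ 2 < ∞ := by
  have hg1 : ∫⁻ z, g z ∂μ < ∞ := by
    have h := lintegral_mul_sq_le (μ := μ) hg.aemeasurable
      (aemeasurable_const (b := (1 : ℝ≥0∞)))
    simp only [mul_one, one_pow, lintegral_one] at h
    have h2 := h.trans_lt (ENNReal.mul_lt_top hg2 (measure_lt_top μ _))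
    by_contra h3
    rw [not_lt_top_iff] at h3
    simp [h3] at h2
  rw [lintegral_balayage_sq hx hy hg]
  calc _ ≤ ∫⁻ z, ∫⁻ w, g z * g w * ENNReal.ofReal (1 / (Real.pi * ε)) ∂μ ∂μ := by
        gcongr with z w
        refine (lintegral_poissonHalfPlane_mul_le_left (hε.trans_le (hyε z))
          (hε.trans_le (hyε w)) _ _).trans (ENNReal.ofReal_le_ofReal ?_)
        have := Real.pi_pos
        apply one_div_le_one_div_of_le (by positivity)
        gcongr
        exact hyε z
    _ = (∫⁻ z, g z ∂μ) * (∫⁻ w, g w ∂μ) * ENNReal.ofReal (1 / (Real.pi * ε)) := by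
        simp_rw [lintegral_mul_const _ (hg.const_mul _), lintegral_const_mul _ hg]
        rw [lintegral_mul_const _ (hg.mul_const _), lintegral_mul_const _ hg]
    _ < ∞ := ENNReal.mul_lt_top (ENNReal.mul_lt_top hg1 hg1) ENNReal.ofReal_lt_top

/-- Let `h` be the balayage. Expanding `∫ h²` as a double integral and applying the bound for
products of kernels gives two symmetric terms, hence `∫ h² ≤ 8 ∫ h(x z) g(z) dμ`. Cauchy–Schwarz and
the hypothesis on the projection bound the square of the right side by `64 c ∫ h² ∫ g²`, and the
finite factor `∫ h²` cancels. -/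
theorem lintegral_balayage_sq_le_of_map_fst (hx : Measurable x) (hy : Measurable y)
    (hg : Measurable g) {ε : ℝ} (hε : 0 < ε) (hyε : ∀ z, ε ≤ y z) {c : ℝ≥0∞}
    (hmap : μ.map x ≤ c • volume) :
    ∫⁻ t, balayage μ x y g t ^ 2 ≤ 64 * c * ∫⁻ z, g z ^ 2 ∂μ := by
  -- If `∫ g²` is infinite the claim is trivial except for `c = 0`, where `0 * ∞ = 0`; but then `μ =
  -- 0`.
  rcases eq_or_ne (∫⁻ z, g z ^ 2 ∂μ) ∞ with htop | htop
  · rcases eq_or_ne c 0 with rfl | hc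
    · have : μ = 0 := by
        have h0 : μ.map x = 0 := le_antisymm (by simpa using hmap) (Measure.zero_le _)
        exact (Measure.map_eq_zero_iff hx.aemeasurable).1 h0
      simp [this] at htop
    · rw [htop, ENNReal.mul_top (by simp [hc])]; exact le_top
  have hfin := lintegral_balayage_sq_lt_top hx hy hg hε hyε (lt_top_iff_ne_top.2 htop)
  set h := balayage μ x y g with hh
  have mh : Measurable h := measurable_balayage hx hy hg
  have mk := measurable_poissonHalfPlane_comp hx hy
  have mK : Measurable fun p : X × X =>
      ENNReal.ofReal (poissonHalfPlane (y p.1) (x p.1 - x p.2)) :=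
    mk.comp (measurable_fst.prodMk (hx.comp measurable_snd))
  have mgg : Measurable fun p : X × X => g p.1 * g p.2 :=
    (hg.comp measurable_fst).mul (hg.comp measurable_snd)
  have hin : ∫⁻ z, ∫⁻ w, g z * g w * (4 * ENNReal.ofReal (poissonHalfPlane (y w) (x w - x z))) ∂μ ∂μ
      = 4 * ∫⁻ z, h (x z) * g z ∂μ := by
    rw [← lintegral_const_mul' _ _ (by norm_num)]
    refine lintegral_congr fun z => ?_
    have hm : Measurable fun w => ENNReal.ofReal (poissonHalfPlane (y w) (x w - x z)) * g w :=
      (mk.comp measurable_prodMk_right).mul hg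
    rw [hh, balayage, ← lintegral_mul_const _ hm, ← lintegral_const_mul _ (hm.mul_const _)]
    refine lintegral_congr fun w => by ring
  have hsq : ∫⁻ t, h t ^ 2 ≤ 8 * ∫⁻ z, h (x z) * g z ∂μ := by
    rw [hh, lintegral_balayage_sq hx hy hg, ← hh]
    calc _ ≤ ∫⁻ z, ∫⁻ w, (g z * g w * (4 * ENNReal.ofReal (poissonHalfPlane (y z) (x z - x w))) +
          g z * g w * (4 * ENNReal.ofReal (poissonHalfPlane (y w) (x w - x z)))) ∂μ ∂μ := by
          gcongr with z w
          rw [← mul_add]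
          gcongr
          exact lintegral_poissonHalfPlane_mul_le_add (hε.trans_le (hyε z))
            (hε.trans_le (hyε w)) _ _
      _ = (∫⁻ z, ∫⁻ w, g z * g w * (4 * ENNReal.ofReal (poissonHalfPlane (y z) (x z - x w))) ∂μ ∂μ)
          + ∫⁻ z, ∫⁻ w, g z * g w *
            (4 * ENNReal.ofReal (poissonHalfPlane (y w) (x w - x z))) ∂μ ∂μ := by
          have m1 : Measurable fun p : X × X => g p.1 * g p.2 *
              (4 * ENNReal.ofReal (poissonHalfPlane (y p.1) (x p.1 - x p.2))) :=
            mgg.mul (mK.const_mul _)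
          rw [← lintegral_add_left m1.lintegral_prod_right']
          refine lintegral_congr fun z => ?_
          exact lintegral_add_left (m1.comp measurable_prodMk_left) _
      _ = 8 * ∫⁻ z, h (x z) * g z ∂μ := by
          rw [lintegral_lintegral_swap]
          · have : ∀ z w, g w * g z * (4 * ENNReal.ofReal (poissonHalfPlane (y w) (x w - x z)))
              = g z * g w * (4 * ENNReal.ofReal (poissonHalfPlane (y w) (x w - x z))) := by
              intro z w; rw [mul_comm (g w)]
            simp_rw [this]
            rw [hin, ← add_mul]; norm_num
          · exact (mgg.mul (mK.const_mul _)).aemeasurable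
  have hcs : (∫⁻ t, h t ^ 2) ^ 2 ≤ (64 * c * ∫⁻ z, g z ^ 2 ∂μ) * ∫⁻ t, h t ^ 2 := by
    calc _ ≤ (8 * ∫⁻ z, h (x z) * g z ∂μ) ^ 2 := by gcongr
      _ = 64 * (∫⁻ z, h (x z) * g z ∂μ) ^ 2 := by rw [mul_pow]; norm_num
      _ ≤ 64 * ((∫⁻ z, h (x z) ^ 2 ∂μ) * ∫⁻ z, g z ^ 2 ∂μ) := by
          gcongr
          exact lintegral_mul_sq_le (mh.comp hx).aemeasurable hg.aemeasurable
      _ ≤ 64 * ((c * ∫⁻ t, h t ^ 2) * ∫⁻ z, g z ^ 2 ∂μ) := by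
          gcongr
          rw [← lintegral_map (f := fun t => h t ^ 2) (mh.pow_const 2) hx,
            ← smul_eq_mul, ← lintegral_smul_measure]
          exact lintegral_mono' hmap le_rfl
      _ = _ := by ring
  exact ENNReal.le_of_sq_le_mul hcs hfin.ne

/-- The Schur integral of the kernel `1/(y + s)` with weight `s^(-1/2)`, independent of `y` by
homogeneity. Below `s = y` use `1/(y + s) ≤ 1/y`, above it `1/(y + s) ≤ 1/s`; each range contributes
`2`. -/
theorem lintegral_inv_sqrt_mul_add_le {y : ℝ} (hy : 0 < y) :
    ∫⁻ s in Set.Ioi (0 : ℝ), ENNReal.ofReal (1 / (y + s) * (√y / √s)) ≤ 4 := by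
  have hsplit : Set.Ioi (0 : ℝ) = Set.Ioc 0 y ∪ Set.Ioi y := (Set.Ioc_union_Ioi_eq_Ioi hy.le).symm
  rw [hsplit]
  refine (lintegral_union_le _ _ _).trans ?_
  have e4 : (4 : ℝ≥0∞) = ENNReal.ofReal 2 + ENNReal.ofReal 2 := by
    rw [← ENNReal.ofReal_add] <;> norm_num
  rw [e4]
  refine add_le_add ?_ ?_
  · have hint : IntegrableOn (fun s : ℝ => y ^ (-(1 / 2) : ℝ) * s ^ (-(1 / 2) : ℝ)) (Set.Ioc 0 y) := by
      have := (intervalIntegral.intervalIntegrable_rpow' (a := 0) (b := y)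
        (r := (-(1 / 2) : ℝ)) (by norm_num)).const_mul (y ^ (-(1 / 2) : ℝ))
      rwa [intervalIntegrable_iff_integrableOn_Ioc_of_le hy.le] at this
    calc _ ≤ ∫⁻ s in Set.Ioc 0 y, ENNReal.ofReal (y ^ (-(1 / 2) : ℝ) * s ^ (-(1 / 2) : ℝ)) := by
          refine setLIntegral_mono' measurableSet_Ioc fun s hs => ENNReal.ofReal_le_ofReal ?_
          rw [Real.rpow_neg hy.le, Real.rpow_neg hs.1.le, ← Real.sqrt_eq_rpow, ← Real.sqrt_eq_rpow]
          have h1 : 0 < √y := Real.sqrt_pos.2 hy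
          have h2 : 0 < √s := Real.sqrt_pos.2 hs.1
          have h3 : √y * √y = y := Real.mul_self_sqrt hy.le
          rw [← one_div, ← one_div, div_mul_div_comm, div_mul_div_comm, div_le_div_iff₀
            (by have := hs.1; positivity) (by positivity)]
          have := hs.1
          nlinarith [mul_pos h2 this]
      _ = ENNReal.ofReal (∫ s in Set.Ioc 0 y, y ^ (-(1 / 2) : ℝ) * s ^ (-(1 / 2) : ℝ)) := by
          rw [← ofReal_integral_eq_lintegral_ofReal hint]
          refine (ae_restrict_iff' measurableSet_Ioc).2 (ae_of_all _ fun s hs => ?_)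
          have := hs.1
          positivity
      _ ≤ _ := by
          apply ENNReal.ofReal_le_ofReal
          rw [← intervalIntegral.integral_of_le hy.le, intervalIntegral.integral_const_mul,
            integral_rpow (Or.inl (by norm_num)), Real.zero_rpow (by norm_num), sub_zero,
            mul_div_assoc', ← Real.rpow_add hy]
          norm_num
  · have hint : IntegrableOn (fun s : ℝ => y ^ (1 / 2 : ℝ) * s ^ (-(3 / 2) : ℝ)) (Set.Ioi y) :=
      (integrableOn_Ioi_rpow_of_lt (by norm_num) hy).const_mul _
    calc _ ≤ ∫⁻ s in Set.Ioi y, ENNReal.ofReal (y ^ (1 / 2 : ℝ) * s ^ (-(3 / 2) : ℝ)) := by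
          refine setLIntegral_mono' measurableSet_Ioi fun s hs => ENNReal.ofReal_le_ofReal ?_
          have hs0 : 0 < s := hy.trans hs
          have e : s ^ (-(3 / 2) : ℝ) = 1 / (s * √s) := by
            rw [show (-(3 / 2) : ℝ) = -(1 + 1 / 2) by norm_num, Real.rpow_neg hs0.le,
              Real.rpow_add hs0, Real.rpow_one, ← Real.sqrt_eq_rpow, one_div]
          rw [e, ← Real.sqrt_eq_rpow]
          have h1 : 0 < √y := Real.sqrt_pos.2 hy
          have h2 : 0 < √s := Real.sqrt_pos.2 hs0
          rw [div_mul_div_comm, mul_div_assoc', div_le_div_iff₀ (by positivity) (by positivity)]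
          nlinarith [mul_pos h1 h2, mul_pos (mul_pos h1 h2) hy]
      _ = ENNReal.ofReal (∫ s in Set.Ioi y, y ^ (1 / 2 : ℝ) * s ^ (-(3 / 2) : ℝ)) := by
          rw [← ofReal_integral_eq_lintegral_ofReal hint]
          refine (ae_restrict_iff' measurableSet_Ioi).2 (ae_of_all _ fun s hs => ?_)
          have : 0 < s := hy.trans hs
          positivity
      _ ≤ _ := by
          apply ENNReal.ofReal_le_ofReal
          rw [integral_const_mul, integral_Ioi_rpow_of_lt (by norm_num) hy, mul_div_assoc',
            mul_neg, ← Real.rpow_add hy]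
          norm_num

/-- The horizontal positions are discarded: the product of two kernels integrates to at most `1/(y z
+ y w)`. What remains is Schur's test with weight `y^(-1/2)`, where the hypothesis on the heights
allows comparison with Lebesgue measure. -/
theorem lintegral_balayage_sq_le_of_map_snd (hx : Measurable x) (hy : Measurable y)
    (hg : Measurable g) (hy0 : ∀ z, 0 < y z) {c : ℝ≥0∞} (hmap : μ.map y ≤ c • volume) :
    ∫⁻ t, balayage μ x y g t ^ 2 ≤ 4 * c * ∫⁻ z, g z ^ 2 ∂μ := by
  have key : ∀ z, ∫⁻ w, ENNReal.ofReal (1 / (y z + y w) * (√(y z) / √(y w))) ∂μ ≤ 4 * c := by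
    intro z
    have hm : Measurable fun s : ℝ => ENNReal.ofReal (1 / (y z + s) * (√(y z) / √s)) := by
      fun_prop
    have hpos : μ.map y = (μ.map y).restrict (Set.Ioi 0) := by
      rw [Measure.restrict_eq_self_of_ae_mem]
      exact (ae_map_iff hy.aemeasurable measurableSet_Ioi).2 (ae_of_all _ hy0)
    calc _ = ∫⁻ s in Set.Ioi (0 : ℝ), ENNReal.ofReal (1 / (y z + s) * (√(y z) / √s)) ∂(μ.map y) := by
          rw [← hpos, lintegral_map hm hy]
      _ ≤ ∫⁻ s in Set.Ioi (0 : ℝ), ENNReal.ofReal (1 / (y z + s) * (√(y z) / √s))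
            ∂(c • volume) := lintegral_mono' (Measure.restrict_mono le_rfl hmap) le_rfl
      _ ≤ c * 4 := by
          rw [Measure.restrict_smul, lintegral_smul_measure, smul_eq_mul]
          gcongr
          exact lintegral_inv_sqrt_mul_add_le (hy0 z)
      _ = 4 * c := mul_comm _ _
  set k : X → X → ℝ≥0∞ := fun z w => ENNReal.ofReal (1 / (y z + y w) * (√(y z) / √(y w))) with hk
  have mk : Measurable fun p : X × X => g p.1 ^ 2 * k p.1 p.2 := by
    simp only [hk]; fun_prop
  have amgm : ∀ z w, 2 * (g z * g w * ENNReal.ofReal (1 / (y z + y w))) ≤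
      g z ^ 2 * k z w + g w ^ 2 * k w z := by
    intro z w
    have h1 : 0 < y z := hy0 z
    have h2 : 0 < y w := hy0 w
    have s1 := Real.sqrt_pos.2 h1
    have s2 := Real.sqrt_pos.2 h2
    -- Fourth roots of the ratio of heights: `r * r' = 1`, while `r ^ 2` and `r' ^ 2` are the Schur
    -- weights in `k z w` and `k w z`. The claim is then `2ab ≤ a² + b²`.
    set r : ℝ≥0∞ := ENNReal.ofReal (√(√(y z) / √(y w))) with hr
    set r' : ℝ≥0∞ := ENNReal.ofReal (√(√(y w) / √(y z))) with hr'
    have hrr : r * r' = 1 := by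
      rw [hr, hr', ← ENNReal.ofReal_mul (by positivity), ← Real.sqrt_mul (by positivity),
        div_mul_div_cancel₀ s2.ne', div_self s1.ne']
      simp
    have e1 : k z w = ENNReal.ofReal (1 / (y z + y w)) * r ^ 2 := by
      rw [hr, ← ENNReal.ofReal_pow (by positivity), Real.sq_sqrt (by positivity),
        ← ENNReal.ofReal_mul (by positivity)]
    have e2 : k w z = ENNReal.ofReal (1 / (y z + y w)) * r' ^ 2 := by
      rw [hr', ← ENNReal.ofReal_pow (by positivity), Real.sq_sqrt (by positivity),
        ← ENNReal.ofReal_mul (by positivity), add_comm (y z)]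
    have h := ENNReal.two_mul_le_sq_add_sq (g z * r) (g w * r')
    rw [e1, e2]
    calc _ = ENNReal.ofReal (1 / (y z + y w)) * (2 * (g z * g w)) * (r * r') := by rw [hrr]; ring
      _ = ENNReal.ofReal (1 / (y z + y w)) * (2 * (g z * r) * (g w * r')) := by ring
      _ ≤ ENNReal.ofReal (1 / (y z + y w)) * ((g z * r) ^ 2 + (g w * r') ^ 2) := by gcongr
      _ = _ := by ring
  have hdiag : ∫⁻ z, ∫⁻ w, g z ^ 2 * k z w ∂μ ∂μ ≤ 4 * c * ∫⁻ z, g z ^ 2 ∂μ := by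
    rw [← lintegral_const_mul _ (hg.pow_const 2)]
    refine lintegral_mono fun z => ?_
    rw [lintegral_const_mul _ (by simp only [hk]; fun_prop), mul_comm]
    gcongr
    exact key z
  have h2 : 2 * ∫⁻ t, balayage μ x y g t ^ 2 ≤ 2 * (4 * c * ∫⁻ z, g z ^ 2 ∂μ) := by
    rw [lintegral_balayage_sq hx hy hg]
    calc _ ≤ 2 * ∫⁻ z, ∫⁻ w, g z * g w * ENNReal.ofReal (1 / (y z + y w)) ∂μ ∂μ := by
          refine mul_le_mul_right (lintegral_mono fun z => lintegral_mono fun w => ?_) _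
          refine mul_le_mul_right ?_ _
          exact lintegral_poissonHalfPlane_mul_le_inv (hy0 z) (hy0 w) _ _
      _ = ∫⁻ z, ∫⁻ w, 2 * (g z * g w * ENNReal.ofReal (1 / (y z + y w))) ∂μ ∂μ := by
          have m0 : Measurable fun p : X × X =>
              g p.1 * g p.2 * ENNReal.ofReal (1 / (y p.1 + y p.2)) := by fun_prop
          rw [← lintegral_const_mul _ m0.lintegral_prod_right']
          refine lintegral_congr fun z => ?_
          exact (lintegral_const_mul _ (m0.comp measurable_prodMk_left)).symm
      _ ≤ ∫⁻ z, ∫⁻ w, (g z ^ 2 * k z w + g w ^ 2 * k w z) ∂μ ∂μ := by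
          gcongr with z w
          exact amgm z w
      _ = (∫⁻ z, ∫⁻ w, g z ^ 2 * k z w ∂μ ∂μ) + ∫⁻ z, ∫⁻ w, g w ^ 2 * k w z ∂μ ∂μ := by
          rw [← lintegral_add_left mk.lintegral_prod_right']
          refine lintegral_congr fun z => ?_
          exact lintegral_add_left (mk.comp measurable_prodMk_left) _
      _ = (∫⁻ z, ∫⁻ w, g z ^ 2 * k z w ∂μ ∂μ) + ∫⁻ z, ∫⁻ w, g z ^ 2 * k z w ∂μ ∂μ := by
          congr 1
          exact lintegral_lintegral_swap (mk.comp measurable_swap).aemeasurable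
      _ ≤ _ := by rw [two_mul]; gcongr
  exact (ENNReal.mul_le_mul_iff_right (by norm_num) (by norm_num)).1 h2

/-- A Carleson embedding inequality for Poisson integrals, deduced from its dual. -/
theorem lintegral_sq_le_of_le_poisson (hx : Measurable x) (hy : Measurable y)
    (hg : Measurable g) (hg2 : ∫⁻ z, g z ^ 2 ∂μ ≠ ∞) {f : ℝ → ℝ≥0∞} (hf : Measurable f)
    (hgf : ∀ᵐ z ∂μ, g z ≤ ∫⁻ t, ENNReal.ofReal (poissonHalfPlane (y z) (x z - t)) * f t)
    {B : ℝ≥0∞} (hB : ∫⁻ t, balayage μ x y g t ^ 2 ≤ B * ∫⁻ z, g z ^ 2 ∂μ) :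
    ∫⁻ z, g z ^ 2 ∂μ ≤ B * ∫⁻ t, f t ^ 2 := by
  refine ENNReal.le_of_sq_le_mul ?_ hg2
  -- Duality: `∫ g²` is at most `g` paired with the Poisson integral of `f`, which by Tonelli is `f`
  -- paired with the balayage of `g`.
  calc (∫⁻ z, g z ^ 2 ∂μ) ^ 2 ≤ (∫⁻ t, f t * balayage μ x y g t) ^ 2 := by
        gcongr
        rw [lintegral_mul_balayage hx hy hg hf]
        refine lintegral_mono_ae (hgf.mono fun z hz => ?_)
        rw [sq]; gcongr
    _ ≤ (∫⁻ t, f t ^ 2) * ∫⁻ t, balayage μ x y g t ^ 2 :=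
        lintegral_mul_sq_le hf.aemeasurable (measurable_balayage hx hy hg).aemeasurable
    _ ≤ (∫⁻ t, f t ^ 2) * (B * ∫⁻ z, g z ^ 2 ∂μ) := by gcongr
    _ = _ := by ring

end Balayage

/-! ### Primitives and decay at infinity -/

/-- An analytic function of order `O(|z|⁻²)` on a domain invariant under dilations of ratio at least
one has a primitive there, given by integration along rays to infinity. -/
theorem exists_primitive_of_dilation_invariant {U : Set ℂ} (hU : IsOpen U)
    (hs : ∀ z ∈ U, ∀ s : ℝ, 1 ≤ s → (s : ℂ) * z ∈ U) (h0 : (0 : ℂ) ∉ U) {g : ℂ → ℂ}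
    (hg : DifferentiableOn ℂ g U) {M : ℝ} (hM : ∀ z ∈ U, ‖g z‖ * ‖z‖ ^ 2 ≤ M) :
    ∃ Φ : ℂ → ℂ, (∀ z ∈ U, HasDerivAt Φ (g z) z) ∧ ∀ z ∈ U, ‖Φ z‖ * ‖z‖ ≤ M := by
  have hne : ∀ z ∈ U, 0 < ‖z‖ := fun z hz => norm_pos_iff.2 fun h => h0 (h ▸ hz)
  have hM0 : ∀ z ∈ U, 0 ≤ M := fun z hz => (by positivity : 0 ≤ ‖g z‖ * ‖z‖ ^ 2).trans (hM z hz)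
  have hbd : ∀ z ∈ U, ∀ s : ℝ, 1 ≤ s → ‖g (s * z)‖ ≤ M / ‖z‖ ^ 2 * s ^ (-2 : ℝ) := by
    intro z hz s h1
    have hs0 : 0 < s := by linarith
    have h := hM _ (hs z hz s h1)
    have hz0 := hne z hz
    rw [norm_mul, Complex.norm_real, Real.norm_of_nonneg hs0.le, mul_pow] at h
    rw [Real.rpow_neg hs0.le, Real.rpow_two, ← div_eq_mul_inv, div_div, le_div_iff₀ (by positivity)]
    linarith
  have hpow : IntegrableOn (fun s : ℝ => s ^ (-2 : ℝ)) (Set.Ioi 1) :=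
    integrableOn_Ioi_rpow_of_lt (by norm_num) one_pos
  have hcont : ∀ z ∈ U, ContinuousOn (fun s : ℝ => g (s * z)) (Set.Ioi 1) := by
    intro z hz
    exact hg.continuousOn.comp (by fun_prop) fun s h1 => hs z hz s (le_of_lt h1)
  have hg' : DifferentiableOn ℂ (deriv g) U := hg.deriv hU
  have hcont' : ∀ z ∈ U, ContinuousOn (fun s : ℝ => deriv g (s * z)) (Set.Ioi 1) := by
    intro z hz
    exact hg'.continuousOn.comp (by fun_prop) fun s h1 => hs z hz s (le_of_lt h1)
  have hint : ∀ z ∈ U, IntegrableOn (fun s : ℝ => g (s * z) * z) (Set.Ioi 1) := by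
    intro z hz
    refine Integrable.mul_const ?_ _
    refine Integrable.mono' (hpow.const_mul (M / ‖z‖ ^ 2))
      ((hcont z hz).aestronglyMeasurable measurableSet_Ioi) ?_
    exact (ae_restrict_iff' measurableSet_Ioi).2 (ae_of_all _ fun s h1 => hbd z hz s (le_of_lt h1))
  refine ⟨fun z => -∫ s in Set.Ioi (1 : ℝ), g (s * z) * z, fun z₀ hz₀ => ?_, fun z hz => ?_⟩
  · obtain ⟨ε₀, hε₀, hball⟩ := Metric.isOpen_iff.1 hU z₀ hz₀
    have hz₀' := hne z₀ hz₀
    have hε₀z : ε₀ ≤ ‖z₀‖ := by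
      by_contra h
      exact h0 (hball (by simpa using not_le.1 h))
    have hM' := hM0 z₀ hz₀
    have hV : ∀ v ∈ Metric.ball z₀ (ε₀ / 2), v ∈ U ∧ ‖z₀‖ / 2 ≤ ‖v‖ ∧ ‖v‖ ≤ 2 * ‖z₀‖ := by
      intro v hv
      rw [Metric.mem_ball, dist_eq_norm] at hv
      refine ⟨hball (by rw [Metric.mem_ball, dist_eq_norm]; linarith), ?_, ?_⟩
      · have := norm_sub_norm_le z₀ v
        rw [norm_sub_rev] at this; linarith
      · have := norm_sub_norm_le v z₀
        linarith
    -- Cauchy's estimate on a disc about `s z` whose radius grows with `s`, namely the dilation of a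
    -- fixed disc about `z`. The extra factor `1/s` absorbs the `s` produced by differentiating `g
    -- (s z)`, so the derivative stays `O(s⁻²)`.
    have hderiv_bd : ∀ z ∈ Metric.ball z₀ (ε₀ / 4), ∀ s : ℝ, 1 ≤ s →
        ‖deriv g (s * z)‖ ≤ M / (‖z₀‖ / 2) ^ 2 * s ^ (-2 : ℝ) / (s * (ε₀ / 8)) := by
      intro z hz s h1
      have hs0 : 0 < s := by linarith
      have hsC : (s : ℂ) ≠ 0 := by exact_mod_cast hs0.ne'
      have hmem : ∀ w ∈ Metric.closedBall ((s : ℂ) * z) (s * (ε₀ / 8)),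
          ∃ v ∈ Metric.ball z₀ (ε₀ / 2), w = s * v := by
        intro w hw
        refine ⟨w / s, ?_, (mul_div_cancel₀ w hsC).symm⟩
        rw [Metric.mem_ball, dist_eq_norm] at hz ⊢
        rw [Metric.mem_closedBall, dist_eq_norm] at hw
        have : ‖w / s - z‖ ≤ ε₀ / 8 := by
          have e : w / s - z = (w - s * z) / s := by rw [sub_div, mul_div_cancel_left₀ z hsC]
          rw [e, norm_div, Complex.norm_real, Real.norm_of_nonneg hs0.le, div_le_iff₀ hs0]
          linarith
        calc ‖w / s - z₀‖ = ‖(w / s - z) + (z - z₀)‖ := by ring_nf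
          _ ≤ _ := norm_add_le _ _
          _ < ε₀ / 2 := by linarith
      refine Complex.norm_deriv_le_of_forall_mem_sphere_norm_le (by positivity) ?_ ?_
      · refine hg.diffContOnCl_ball fun w hw => ?_
        obtain ⟨v, hv, rfl⟩ := hmem w hw
        exact hs v (hV v hv).1 s h1
      · intro w hw
        obtain ⟨v, hv, rfl⟩ := hmem w (Metric.sphere_subset_closedBall hw)
        obtain ⟨hvU, hv1, -⟩ := hV v hv
        refine (hbd v hvU s h1).trans ?_
        gcongr
    have key := hasDerivAt_integral_of_dominated_loc_of_deriv_le
      (μ := volume.restrict (Set.Ioi (1 : ℝ))) (F := fun z (s : ℝ) => g (s * z) * z)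
      (F' := fun z (s : ℝ) => deriv g (s * z) * s * z + g (s * z))
      (bound := fun s : ℝ => (M / (‖z₀‖ / 2) ^ 2 / (ε₀ / 8) * (2 * ‖z₀‖) + M / (‖z₀‖ / 2) ^ 2) *
        s ^ (-2 : ℝ))
      (x₀ := z₀) (s := Metric.ball z₀ (ε₀ / 4)) (Metric.ball_mem_nhds _ (by positivity)) ?_
      (hint z₀ hz₀) ?_ ?_ (hpow.const_mul _) ?_
    · obtain ⟨hI, hD⟩ := key
      -- The differentiated integrand is the `s`-derivative of `s g(s z₀)`, which vanishes at
      -- infinity.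
      have hfin : ∫ s in Set.Ioi (1 : ℝ), (deriv g (s * z₀) * s * z₀ + g (s * z₀)) = -g z₀ := by
        have hd : ∀ s ∈ Set.Ici (1 : ℝ), HasDerivAt (fun s : ℝ => (s : ℂ) * g (s * z₀))
            (deriv g (s * z₀) * s * z₀ + g (s * z₀)) s := by
          intro s h1
          have hgd : HasDerivAt g (deriv g (s * z₀)) (s * z₀) :=
            (hg.differentiableAt (hU.mem_nhds (hs z₀ hz₀ s h1))).hasDerivAt
          have h2 : HasDerivAt (fun s : ℂ => s * z₀) (1 * z₀) (s : ℂ) :=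
            (hasDerivAt_id' (s : ℂ)).mul_const z₀
          have h3 := ((hasDerivAt_id' (s : ℂ)).mul
            (HasDerivAt.comp (s : ℂ) hgd h2)).comp_ofReal
          refine h3.congr_deriv ?_
          simp only [Function.comp]; ring
        have ht : Tendsto (fun s : ℝ => (s : ℂ) * g (s * z₀)) atTop (𝓝 0) := by
          rw [tendsto_zero_iff_norm_tendsto_zero]
          have hlim : Tendsto (fun s : ℝ => M / ‖z₀‖ ^ 2 * s⁻¹) atTop (𝓝 0) := by
            simpa using tendsto_inv_atTop_zero.const_mul (M / ‖z₀‖ ^ 2)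
          refine squeeze_zero' (Eventually.of_forall fun _ => norm_nonneg _) ?_ hlim
          filter_upwards [eventually_ge_atTop 1] with s h1
          have hs0 : 0 < s := by linarith
          have := hbd z₀ hz₀ s h1
          rw [norm_mul, Complex.norm_real, Real.norm_of_nonneg hs0.le]
          calc s * ‖g (s * z₀)‖ ≤ s * (M / ‖z₀‖ ^ 2 * s ^ (-2 : ℝ)) := by gcongr
            _ = _ := by
              rw [Real.rpow_neg hs0.le, Real.rpow_two]; field_simp
        have := integral_Ioi_of_hasDerivAt_of_tendsto' hd hI ht
        simpa using this
      rw [hfin] at hD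
      simpa only [neg_neg] using! hD.neg
    · filter_upwards [Metric.ball_mem_nhds z₀ (show 0 < ε₀ / 2 by positivity)] with z hz
      exact (hint z (hV z hz).1).aestronglyMeasurable
    · refine ContinuousOn.aestronglyMeasurable ?_ measurableSet_Ioi
      exact (((hcont' z₀ hz₀).mul Complex.continuous_ofReal.continuousOn).mul
        continuousOn_const).add (hcont z₀ hz₀)
    · refine (ae_restrict_iff' measurableSet_Ioi).2 (ae_of_all _ fun s h1 z hz => ?_)
      have h1' : (1 : ℝ) ≤ s := le_of_lt h1
      have hs0 : 0 < s := by linarith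
      obtain ⟨hzU, hz1, hz2⟩ := hV z (Metric.ball_subset_ball (by linarith) hz)
      have e1 := hderiv_bd z hz s h1'
      have e2 := hbd z hzU s h1'
      calc _ ≤ ‖deriv g (s * z)‖ * s * ‖z‖ + ‖g (s * z)‖ := by
            refine (norm_add_le _ _).trans ?_
            rw [norm_mul, norm_mul, Complex.norm_real, Real.norm_of_nonneg hs0.le]
        _ ≤ (M / (‖z₀‖ / 2) ^ 2 * s ^ (-2 : ℝ) / (s * (ε₀ / 8))) * s * (2 * ‖z₀‖) +
            M / (‖z₀‖ / 2) ^ 2 * s ^ (-2 : ℝ) := by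
            gcongr
            refine e2.trans ?_
            gcongr
        _ = _ := by field_simp
    · refine (ae_restrict_iff' measurableSet_Ioi).2 (ae_of_all _ fun s h1 z hz => ?_)
      obtain ⟨hzU, -, -⟩ := hV z (Metric.ball_subset_ball (by linarith) hz)
      have hgd : HasDerivAt g (deriv g (s * z)) (s * z) :=
        (hg.differentiableAt (hU.mem_nhds (hs z hzU s (le_of_lt h1)))).hasDerivAt
      have h2 : HasDerivAt (fun z : ℂ => (s : ℂ) * z) ((s : ℂ) * 1) z :=
        (hasDerivAt_id' z).const_mul (s : ℂ)
      refine ((HasDerivAt.comp z hgd h2).mul (hasDerivAt_id' z)).congr_deriv ?_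
      simp only [Function.comp]; ring
  · have hz0 := hne z hz
    rw [norm_neg]
    have : ‖∫ s in Set.Ioi (1 : ℝ), g (s * z) * z‖ ≤
        ∫ s in Set.Ioi (1 : ℝ), M / ‖z‖ ^ 2 * s ^ (-2 : ℝ) * ‖z‖ := by
      refine norm_integral_le_of_norm_le ((hpow.const_mul _).mul_const _) ?_
      refine (ae_restrict_iff' measurableSet_Ioi).2 (ae_of_all _ fun s h1 => ?_)
      rw [norm_mul]
      gcongr
      exact hbd z hz s (le_of_lt h1)
    rw [integral_mul_const (‖z‖), integral_const_mul, integral_Ioi_rpow_of_lt (by norm_num) one_pos] at this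
    calc _ ≤ M / ‖z‖ ^ 2 * ‖z‖ * ‖z‖ := by
          gcongr
          refine this.trans_eq ?_
          norm_num
      _ = M := by field_simp

/-- Near infinity, `v ↦ F (1/v)` extends analytically to `v = 0` with value `0`, hence is `O(|v|)`.
The rest of the closed exterior is compact. -/
theorem IsRegularOutside.exists_norm_mul_le {K : Set ℂ} (hK : IsCompact K) {F : ℂ → ℂ}
    (hF : IsRegularOutside K F) : ∃ M, ∀ z ∈ closure Kᶜ, ‖F z‖ * ‖z‖ ≤ M := by
  obtain ⟨R, hR⟩ := hK.isBounded.subset_closedBall 0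
  set R' := max R 1
  have hR' : 0 < R' := lt_of_lt_of_le one_pos (le_max_right _ _)
  have hout : ∀ z : ℂ, R' < ‖z‖ → z ∈ Kᶜ := by
    intro z hz hzK
    have := hR hzK
    rw [mem_closedBall_zero_iff] at this
    linarith [le_max_left R 1]
  set k : ℂ → ℂ := Function.update (fun v => F v⁻¹) 0 0 with hk
  have hball : Metric.ball (0 : ℂ) R'⁻¹ ∈ 𝓝 (0 : ℂ) := Metric.ball_mem_nhds _ (by positivity)
  have hkd : DifferentiableOn ℂ k (Metric.ball 0 R'⁻¹) := by
    refine (Complex.differentiableOn_compl_singleton_and_continuousAt_iff hball).1 ⟨?_, ?_⟩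
    · have : DifferentiableOn ℂ (fun v => F v⁻¹) (Metric.ball 0 R'⁻¹ \ {0}) := by
        refine hF.differentiableOn.comp (fun v hv => ?_) fun v hv => ?_
        · exact (differentiableAt_inv hv.2).differentiableWithinAt
        · have hv0 : 0 < ‖v‖ := norm_pos_iff.2 hv.2
          have h1 : ‖v‖ < R'⁻¹ := by simpa using hv.1
          refine hout _ ?_
          rw [norm_inv]
          exact (lt_inv_comm₀ hR' hv0).2 h1
      refine this.congr fun v hv => ?_
      rw [hk, Function.update_of_ne hv.2]
    · rw [hk, continuousAt_update_same]
      exact hF.tendsto_zero.comp (Filter.tendsto_inv₀_nhdsNE_zero.mono_right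
        (by rw [Metric.cobounded_eq_cocompact]))
  have hO := (hkd.differentiableAt hball).hasDerivAt.isBigO_sub
  obtain ⟨C, hC⟩ := hO.bound
  obtain ⟨δ, hδ, hδ'⟩ := Metric.eventually_nhds_iff.1 hC
  have hcpt : IsCompact (closure Kᶜ ∩ Metric.closedBall 0 δ⁻¹) :=
    (isCompact_closedBall _ _).inter_left isClosed_closure
  have hcont : ContinuousOn (fun z => ‖F z‖ * ‖z‖) (closure Kᶜ ∩ Metric.closedBall 0 δ⁻¹) :=
    ((hF.continuousOn.mono Set.inter_subset_left).norm).mul continuous_norm.continuousOn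
  obtain ⟨M, hM⟩ := hcpt.bddAbove_image hcont
  refine ⟨max M C, fun z hz => ?_⟩
  rcases le_or_gt ‖z‖ δ⁻¹ with h | h
  · exact (hM ⟨z, ⟨hz, by simpa using h⟩, rfl⟩).trans (le_max_left _ _)
  · refine le_trans ?_ (le_max_right _ _)
    have hz0 : 0 < ‖z‖ := (by positivity : 0 < δ⁻¹).trans h
    have hz0' : z ≠ 0 := norm_pos_iff.1 hz0
    have := @hδ' z⁻¹ (by
      rw [dist_zero_right, norm_inv]
      exact (inv_lt_comm₀ hδ hz0).1 h)
    rw [hk, Function.update_self, Function.update_of_ne (inv_ne_zero hz0'), inv_inv, sub_zero,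
      sub_zero, norm_inv] at this
    calc _ ≤ C * ‖z‖⁻¹ * ‖z‖ := by gcongr
      _ = C := by field_simp

/-- Near `v` the quotient is continuous on a compact disc; away from `v` it is a bounded function
divided by `z - v`. Subtracting the value at a pole thus keeps one order of decay, and a further
division yields the `O(|z|⁻²)` that primitives require. -/
theorem exists_norm_dslope_mul_le {U : Set ℂ} (hU : IsOpen U) {f : ℂ → ℂ}
    (hf : DifferentiableOn ℂ f U) {M : ℝ} (hM : ∀ z ∈ U, ‖f z‖ ≤ M) {v : ℂ} (hv : v ∈ U) :
    ∃ C, ∀ z ∈ U, ‖dslope f v z‖ * ‖z‖ ≤ C := by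
  obtain ⟨r, hr, hball⟩ := Metric.nhds_basis_closedBall.mem_iff.1 (hU.mem_nhds hv)
  have hd : DifferentiableOn ℂ (dslope f v) U :=
    (Complex.differentiableOn_dslope (hU.mem_nhds hv)).2 hf
  have hcont : ContinuousOn (fun z => ‖dslope f v z‖ * ‖z‖) (Metric.closedBall v r) :=
    ((hd.continuousOn.mono hball).norm).mul continuous_norm.continuousOn
  obtain ⟨C, hC⟩ := (isCompact_closedBall v r).bddAbove_image hcont
  have hM0 : 0 ≤ M := (norm_nonneg _).trans (hM v hv)
  refine ⟨max C (2 * M * (1 + ‖v‖ / r)), fun z hz => ?_⟩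
  rcases le_or_gt (dist z v) r with h | h
  · exact (hC ⟨z, h, rfl⟩).trans (le_max_left _ _)
  · refine le_trans ?_ (le_max_right _ _)
    rw [dist_eq_norm] at h
    have hzv : z ≠ v := by rintro rfl; simp at h; linarith
    have hp : 0 < ‖z - v‖ := hr.trans h
    rw [dslope_of_ne _ hzv, slope_def_field, norm_div]
    have h1 : ‖f z - f v‖ ≤ 2 * M := (norm_sub_le _ _).trans (by linarith [hM z hz, hM v hv])
    have h2 : ‖z‖ ≤ ‖z - v‖ * (1 + ‖v‖ / r) := by
      have h3 : ‖v‖ ≤ ‖z - v‖ * (‖v‖ / r) := by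
        rw [mul_div_assoc', le_div_iff₀ hr, mul_comm]
        gcongr
      have := norm_add_le (z - v) v
      rw [sub_add_cancel] at this
      linarith
    calc ‖f z - f v‖ / ‖z - v‖ * ‖z‖ ≤ 2 * M / ‖z - v‖ * (‖z - v‖ * (1 + ‖v‖ / r)) := by gcongr
      _ = _ := by field_simp

theorem norm_le_mul_norm_sub {r : ℝ} (hr : 0 < r) {z v : ℂ} (h : r ≤ ‖z - v‖) :
    ‖z‖ ≤ (1 + ‖v‖ / r) * ‖z - v‖ := by
  have h3 : ‖v‖ ≤ ‖v‖ / r * ‖z - v‖ := by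
    rw [div_mul_eq_mul_div, le_div_iff₀ hr]
    gcongr
  have := norm_add_le (z - v) v
  rw [sub_add_cancel] at this
  linarith

theorem norm_add_mul_I_sq (x β : ℝ) : ‖(x + β * Complex.I : ℂ)‖ ^ 2 = x ^ 2 + β ^ 2 := by
  rw [Complex.sq_norm, Complex.normSq_apply]
  simp; ring

theorem integrable_inv_sq_add_sq {β : ℝ} (hβ : 0 < β) :
    Integrable fun x : ℝ => (x ^ 2 + β ^ 2)⁻¹ := by
  refine ((integrable_poissonHalfPlane hβ 0).const_mul (Real.pi / β)).congr (ae_of_all _ fun x => ?_)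
  have := Real.pi_ne_zero
  have : x ^ 2 + β ^ 2 ≠ 0 := by positivity
  simp only [poissonHalfPlane]
  field_simp
  ring

theorem integrable_of_norm_mul_norm_sq_le {β : ℝ} (hβ : 0 < β) {f : ℝ → ℂ} (hf : Continuous f)
    {M : ℝ} (hM : ∀ x : ℝ, ‖f x‖ * ‖(x + β * Complex.I : ℂ)‖ ^ 2 ≤ M) : Integrable f := by
  refine Integrable.mono' ((integrable_inv_sq_add_sq hβ).const_mul M) hf.aestronglyMeasurable
    (ae_of_all _ fun x => ?_)
  have h := hM x
  rw [norm_add_mul_I_sq] at h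
  rw [← div_eq_mul_inv, le_div_iff₀ (by positivity)]
  exact h

/-! ### Poisson and Cauchy formulas on horizontal lines -/

section HalfPlane

variable {b β : ℝ} {F : ℂ → ℂ}

theorem isOpen_im_gt (b : ℝ) : IsOpen {z : ℂ | b < z.im} :=
  isOpen_lt continuous_const Complex.continuous_im

theorem continuous_comp_line (hF : DifferentiableOn ℂ F {z | b < z.im}) (hβ : b < β) :
    Continuous fun x : ℝ => F (x + β * Complex.I) := by
  refine hF.continuousOn.comp_continuous (by fun_prop) fun x => ?_
  simpa using hβ

/-- A half-plane above the origin is invariant under dilations of ratio at least one, so `F` has a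
primitive there that tends to `0` at both ends of the line. This replaces closing the contour by a
large arc. -/
theorem integral_line_eq_zero (hb : 0 ≤ b) (hβ : b < β)
    (hF : DifferentiableOn ℂ F {z | b < z.im}) {M : ℝ}
    (hM : ∀ z : ℂ, b < z.im → ‖F z‖ * ‖z‖ ^ 2 ≤ M) :
    ∫ x : ℝ, F (x + β * Complex.I) = 0 := by
  obtain ⟨Φ, hΦ, hΦM⟩ := exists_primitive_of_dilation_invariant (isOpen_im_gt b)
    (fun z hz s h1 => by
      simp only [Set.mem_ofPred_eq, Complex.im_ofReal_mul] at hz ⊢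
      nlinarith) (by simpa using hb) hF hM
  have hβ0 : 0 < β := by linarith
  have hmem : ∀ x : ℝ, b < (x + β * Complex.I : ℂ).im := fun x => by simpa using hβ
  have hd : ∀ x : ℝ, HasDerivAt (fun x : ℝ => Φ (x + β * Complex.I)) (F (x + β * Complex.I)) x := by
    intro x
    have h2 : HasDerivAt (fun z : ℂ => z + β * Complex.I) 1 (x : ℂ) :=
      (hasDerivAt_id' (x : ℂ)).add_const _
    have := (HasDerivAt.comp (x : ℂ) (hΦ _ (hmem x)) h2).comp_ofReal
    simpa using this
  have hint : Integrable fun x : ℝ => F (x + β * Complex.I) :=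
    integrable_of_norm_mul_norm_sq_le hβ0 (continuous_comp_line hF hβ) fun x => hM _ (hmem x)
  have hM0 : 0 ≤ M := by
    have := hM _ (hmem 0)
    exact le_trans (by positivity) this
  have hbd : ∀ x : ℝ, ‖Φ (x + β * Complex.I)‖ * |x| ≤ M := by
    intro x
    refine le_trans ?_ (hΦM _ (hmem x))
    gcongr
    have := Complex.abs_re_le_norm (x + β * Complex.I)
    simpa using this
  have hlim : ∀ l : Filter ℝ, Tendsto (fun x : ℝ => |x|) l atTop →
      Tendsto (fun x : ℝ => Φ (x + β * Complex.I)) l (𝓝 0) := by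
    intro l hl
    rw [tendsto_zero_iff_norm_tendsto_zero]
    have : Tendsto (fun x : ℝ => M * |x|⁻¹) l (𝓝 0) := by
      simpa using (tendsto_inv_atTop_zero.comp hl).const_mul M
    refine squeeze_zero' (Eventually.of_forall fun _ => norm_nonneg _) ?_ this
    filter_upwards [hl.eventually_gt_atTop 0] with x hx
    rw [← div_eq_mul_inv, le_div_iff₀ hx]
    exact hbd x
  have := integral_of_hasDerivAt_of_tendsto hd hint (hlim _ tendsto_abs_atBot_atTop)
    (hlim _ tendsto_abs_atTop_atTop)
  simpa using this

/-- The reflection of `z` in the horizontal line at height `β`. -/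
noncomputable def reflectLine (β : ℝ) (z : ℂ) : ℂ := starRingEnd ℂ z + 2 * β * Complex.I

theorem reflectLine_im (β : ℝ) (z : ℂ) : (reflectLine β z).im = 2 * β - z.im := by
  simp [reflectLine]; ring

theorem reflectLine_re (β : ℝ) (z : ℂ) : (reflectLine β z).re = z.re := by
  simp [reflectLine]

theorem sub_reflectLine_of_line (β x : ℝ) (z : ℂ) :
    (x + β * Complex.I : ℂ) - reflectLine β z = starRingEnd ℂ (x + β * Complex.I - z) := by
  simp [reflectLine]; ring

theorem sub_mul_sub_reflectLine (β x : ℝ) (z : ℂ) :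
    ((x + β * Complex.I : ℂ) - z) * ((x + β * Complex.I : ℂ) - reflectLine β z) =
      (((z.re - x) ^ 2 + (z.im - β) ^ 2 : ℝ) : ℂ) := by
  rw [sub_reflectLine_of_line, Complex.mul_conj, Complex.normSq_apply]
  simp; ring

theorem sub_reflectLine_self (β : ℝ) (z : ℂ) :
    z - reflectLine β z = 2 * Complex.I * ((z.im - β : ℝ) : ℂ) := by
  apply Complex.ext <;> simp [reflectLine]
  ring

theorem line_ne {z : ℂ} (hz : z.im ≠ β) (x : ℝ) : (x + β * Complex.I : ℂ) - z ≠ 0 := by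
  intro h
  have := congrArg Complex.im h
  simp at this
  exact hz (by linarith)

theorem line_div_eq_poisson {z : ℂ} (hz : β < z.im) (x : ℝ) :
    (z - reflectLine β z) / (((x + β * Complex.I : ℂ) - z) *
      ((x + β * Complex.I : ℂ) - reflectLine β z)) =
      2 * Real.pi * Complex.I * (poissonHalfPlane (z.im - β) (z.re - x) : ℝ) := by
  have h0 : 0 < z.im - β := by linarith
  have h : (z.re - x) ^ 2 + (z.im - β) ^ 2 ≠ 0 := by positivity
  rw [sub_mul_sub_reflectLine, sub_reflectLine_self, poissonHalfPlane]
  have hp := Real.pi_ne_zero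
  push_cast
  have h' : ((z.re : ℂ) - x) ^ 2 + ((z.im : ℂ) - β) ^ 2 ≠ 0 := by exact_mod_cast h
  have hp' : (Real.pi : ℂ) ≠ 0 := by exact_mod_cast hp
  field_simp

/-- With `z'` the mirror image of `z` in the line, the function `(F w - F z) / ((w - z)(w - z'))`
has a removable singularity at `z`, its other pole below the line, and order `O(|w|⁻²)`, so its
integral vanishes. On the line the kernel is a multiple of the Poisson kernel, which has mass one.
-/
theorem poisson_formula_line (hb : 0 ≤ b) (hβ : b < β)
    (hF : DifferentiableOn ℂ F {z | b < z.im}) {M : ℝ} (hM : ∀ z : ℂ, b < z.im → ‖F z‖ ≤ M)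
    {z : ℂ} (hz : β < z.im) :
    Integrable (fun x : ℝ => (poissonHalfPlane (z.im - β) (z.re - x) : ℂ) * F (x + β * Complex.I)) ∧
    ∫ x : ℝ, (poissonHalfPlane (z.im - β) (z.re - x) : ℂ) * F (x + β * Complex.I) = F z := by
  set z' := reflectLine β z with hz'
  have him : z'.im < β := by rw [hz', reflectLine_im]; linarith
  -- An intermediate height: above it `F` is analytic and `z'` is at a positive distance, and the
  -- line of integration lies in that half-plane.
  obtain ⟨c, hc1, hc2⟩ := exists_between (max_lt hβ him)
  have hbc : b < c := (le_max_left _ _).trans_lt hc1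
  have hzc : z'.im < c := (le_max_right _ _).trans_lt hc1
  have hdist : ∀ w : ℂ, c < w.im → c - z'.im ≤ ‖w - z'‖ := by
    intro w hw
    have := Complex.abs_im_le_norm (w - z')
    rw [Complex.sub_im] at this
    linarith [le_abs_self (w.im - z'.im)]
  have hne : ∀ w : ℂ, c < w.im → w - z' ≠ 0 := fun w hw =>
    norm_pos_iff.1 (lt_of_lt_of_le (by linarith) (hdist w hw))
  have hsub : {w : ℂ | c < w.im} ⊆ {w | b < w.im} := fun w hw => hbc.trans hw
  have hzU : z ∈ {w : ℂ | c < w.im} := hc2.trans hz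
  obtain ⟨C, hC⟩ := exists_norm_dslope_mul_le (isOpen_im_gt c) (hF.mono hsub)
    (fun w hw => hM w (hsub hw)) hzU
  have hd : DifferentiableOn ℂ (dslope F z) {w : ℂ | c < w.im} :=
    (Complex.differentiableOn_dslope ((isOpen_im_gt c).mem_nhds hzU)).2 (hF.mono hsub)
  have h0 := integral_line_eq_zero (F := fun w => dslope F z w / (w - z')) (hb.trans hbc.le) hc2
    (hd.div (by fun_prop) hne) (M := C * (1 + ‖z'‖ / (c - z'.im))) (by
      intro w hw
      have h1 := norm_le_mul_norm_sub (sub_pos.2 hzc) (hdist w hw)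
      have h2 := hC w hw
      have h3 : 0 < ‖w - z'‖ := norm_pos_iff.2 (hne w hw)
      rw [norm_div]
      calc ‖dslope F z w‖ / ‖w - z'‖ * ‖w‖ ^ 2 = (‖dslope F z w‖ * ‖w‖) * (‖w‖ / ‖w - z'‖) := by
            ring
        _ ≤ C * (1 + ‖z'‖ / (c - z'.im)) := by
            have : 0 ≤ C := le_trans (by positivity) h2
            gcongr
            rwa [div_le_iff₀ h3])
  have hline : ∀ x : ℝ, dslope F z (x + β * Complex.I) / ((x + β * Complex.I) - z') * (z - z') =
      2 * Real.pi * Complex.I * ((poissonHalfPlane (z.im - β) (z.re - x) : ℂ) * F (x + β * Complex.I)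
        - (poissonHalfPlane (z.im - β) (z.re - x) : ℂ) * F z) := by
    intro x
    have hne2 := line_ne hz.ne' x
    rw [dslope_of_ne _ (sub_ne_zero.1 hne2), slope_def_field, ← mul_sub, ← mul_assoc,
      ← line_div_eq_poisson hz, div_div, div_mul_eq_mul_div, div_mul_eq_mul_div]
    ring
  have hP := integrable_poissonHalfPlane (sub_pos.2 hz) z.re
  have hPc : Integrable fun x : ℝ => (poissonHalfPlane (z.im - β) (z.re - x) : ℂ) := hP.ofReal
  have hI1 : Integrable (fun x : ℝ =>
      (poissonHalfPlane (z.im - β) (z.re - x) : ℂ) * F (x + β * Complex.I)) :=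
    hPc.mul_bdd (c := M) (continuous_comp_line hF hβ).aestronglyMeasurable
      (ae_of_all _ fun x => hM _ (by simpa using hβ))
  refine ⟨hI1, ?_⟩
  have h1 : ∫ x : ℝ, dslope F z (x + β * Complex.I) / ((x + β * Complex.I) - z') * (z - z') = 0 := by
    rw [integral_mul_const, h0, zero_mul]
  simp_rw [hline] at h1
  rw [integral_const_mul, integral_sub hI1 (hPc.mul_const _), integral_mul_const,
    integral_complex_ofReal, integral_poissonHalfPlane (sub_pos.2 hz)] at h1
  simp only [Complex.ofReal_one, one_mul, mul_eq_zero, Complex.I_ne_zero, OfNat.ofNat_ne_zero,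
    Complex.ofReal_eq_zero, Real.pi_ne_zero, false_or] at h1
  exact sub_eq_zero.1 h1

/-- On the line, `1/(w - z)` is `2πi` times the Poisson kernel plus `1/(w - z')`. The first part
reproduces `F z`; the second integrates to zero because its pole lies below the line. -/
theorem cauchy_formula_line (hb : 0 ≤ b) (hβ : b < β)
    (hF : DifferentiableOn ℂ F {z | b < z.im}) {M M' : ℝ} (hM : ∀ z : ℂ, b < z.im → ‖F z‖ ≤ M)
    (hM' : ∀ z : ℂ, b < z.im → ‖F z‖ * ‖z‖ ≤ M') {z : ℂ} (hz : β < z.im) :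
    ∫ x : ℝ, F (x + β * Complex.I) / ((x + β * Complex.I) - z) = 2 * Real.pi * Complex.I * F z := by
  obtain ⟨hI, hP⟩ := poisson_formula_line hb hβ hF hM hz
  set z' := reflectLine β z with hz'
  have him : z'.im < β := by rw [hz', reflectLine_im]; linarith
  obtain ⟨c, hc1, hc2⟩ := exists_between (max_lt hβ him)
  have hbc : b < c := (le_max_left _ _).trans_lt hc1
  have hzc : z'.im < c := (le_max_right _ _).trans_lt hc1
  have hdist : ∀ w : ℂ, c < w.im → c - z'.im ≤ ‖w - z'‖ := by
    intro w hw
    have := Complex.abs_im_le_norm (w - z')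
    rw [Complex.sub_im] at this
    linarith [le_abs_self (w.im - z'.im)]
  have hne : ∀ w : ℂ, c < w.im → w - z' ≠ 0 := fun w hw =>
    norm_pos_iff.1 (lt_of_lt_of_le (by linarith) (hdist w hw))
  have hsub : {w : ℂ | c < w.im} ⊆ {w | b < w.im} := fun w hw => hbc.trans hw
  have hbound : ∀ w : ℂ, c < w.im →
      ‖F w / (w - z')‖ * ‖w‖ ^ 2 ≤ M' * (1 + ‖z'‖ / (c - z'.im)) := by
    intro w hw
    have h1 := norm_le_mul_norm_sub (sub_pos.2 hzc) (hdist w hw)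
    have h2 := hM' w (hbc.trans hw)
    have h3 : 0 < ‖w - z'‖ := norm_pos_iff.2 (hne w hw)
    rw [norm_div]
    calc ‖F w‖ / ‖w - z'‖ * ‖w‖ ^ 2 = (‖F w‖ * ‖w‖) * (‖w‖ / ‖w - z'‖) := by ring
      _ ≤ _ := by
          have : 0 ≤ M' := le_trans (by positivity) h2
          gcongr
          rwa [div_le_iff₀ h3]
  have hdiff : DifferentiableOn ℂ (fun w => F w / (w - z')) {w : ℂ | c < w.im} :=
    (hF.mono hsub).div (by fun_prop) hne
  have h0 := integral_line_eq_zero (hb.trans hbc.le) hc2 hdiff hbound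
  have hI0 : Integrable fun x : ℝ => F (x + β * Complex.I) / ((x + β * Complex.I) - z') :=
    integrable_of_norm_mul_norm_sq_le (by linarith) (continuous_comp_line hdiff hc2)
      fun x => hbound _ (by simpa using hc2)
  have hsplit : ∀ x : ℝ, F (x + β * Complex.I) / ((x + β * Complex.I) - z) =
      2 * Real.pi * Complex.I *
        ((poissonHalfPlane (z.im - β) (z.re - x) : ℂ) * F (x + β * Complex.I)) +
      F (x + β * Complex.I) / ((x + β * Complex.I) - z') := by
    intro x
    have hn1 := line_ne hz.ne' x
    have hn2 := line_ne (z := z') him.ne x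
    rw [← mul_assoc, ← line_div_eq_poisson hz, ← hz']
    field_simp
    ring
  simp_rw [hsplit]
  rw [integral_add (hI.const_mul _) hI0, integral_const_mul, hP, h0, add_zero]

end HalfPlane

/-! ### Cauchy's formula around `K` and the reflection identity -/

/-- The point of the segment from `a` to `b` with parameter `s`. -/
noncomputable def segPoint (a b : ℂ) (s : ℝ) : ℂ := a + s * (b - a)

/-- The complex line integral of `g` along the segment from `a` to `b`. -/
noncomputable def segIntegral (g : ℂ → ℂ) (a b : ℂ) : ℂ :=
  ∫ s in (0 : ℝ)..1, g (segPoint a b s) * (b - a)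

theorem continuous_segPoint (a b : ℂ) : Continuous (segPoint a b) := by
  unfold segPoint; fun_prop

theorem segIntegral_eq_sub {g Φ : ℂ → ℂ} {a b : ℂ}
    (hg : ContinuousOn (fun s => g (segPoint a b s)) (Set.Icc 0 1))
    (hΦ : ∀ s ∈ Set.Icc (0 : ℝ) 1, HasDerivAt Φ (g (segPoint a b s)) (segPoint a b s)) :
    segIntegral g a b = Φ b - Φ a := by
  have h01 : Set.uIcc (0 : ℝ) 1 = Set.Icc 0 1 := Set.uIcc_of_le zero_le_one
  have := intervalIntegral.integral_eq_sub_of_hasDerivAt (f := fun s => Φ (segPoint a b s))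
    (f' := fun s => g (segPoint a b s) * (b - a)) (a := 0) (b := 1) (fun s hs => ?_) ?_
  · simpa [segIntegral, segPoint] using this
  · rw [h01] at hs
    have h2 : HasDerivAt (fun z : ℂ => a + z * (b - a)) (1 * (b - a)) (s : ℂ) :=
      ((hasDerivAt_id' (s : ℂ)).mul_const (b - a)).const_add a
    have h3 := (HasDerivAt.comp (s : ℂ) (hΦ s hs) h2).comp_ofReal
    simpa [segPoint] using h3
  · apply ContinuousOn.intervalIntegrable
    rw [h01]
    exact hg.mul continuousOn_const

/-- The closed polygon with vertices `p 0, …, p n = p 0` winds once around the origin, avoids `K`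
and lies below height `β`; consecutive vertices are seen from the origin at an acute angle. -/
structure IsPolygonAround (K : Set ℂ) (β : ℝ) (n : ℕ) (p : ℕ → ℂ) : Prop where
  closed : p n = p 0
  notMem : ∀ i < n, ∀ s ∈ Set.Icc (0 : ℝ) 1, segPoint (p i) (p (i + 1)) s ∉ K
  im_lt : ∀ i < n, ∀ s ∈ Set.Icc (0 : ℝ) 1, (segPoint (p i) (p (i + 1)) s).im < β
  re_div_pos : ∀ i < n, 0 < (p (i + 1) / p i).re
  sum_log : ∑ i ∈ Finset.range n, Complex.log (p (i + 1) / p i) = 2 * Real.pi * Complex.I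

section

variable {K : Set ℂ} {β : ℝ} {n : ℕ} {p : ℕ → ℂ} {F : ℂ → ℂ}

/-- The sign is that of the exterior formula: `F` vanishes at infinity and `ζ` is outside the
polygon. With `q w = w F(w)`, which is bounded, one has `F(w)/(w - ζ) = dslope q ζ w / w + F(ζ)/(w -
ζ) - F(ζ)/w`. The first term is `O(|w|⁻²)` and has a primitive, the second has a logarithm below
height `β`, and the third counts the winding number about the origin. -/
theorem IsPolygonAround.segIntegral_cauchy (hp : IsPolygonAround K β n p) (hK : IsCompact K)
    (hconv : Convex ℝ K) (h0 : (0 : ℂ) ∈ K) (hF : DifferentiableOn ℂ F Kᶜ) {M : ℝ}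
    (hM : ∀ z ∈ Kᶜ, ‖F z‖ * ‖z‖ ≤ M) {ζ : ℂ} (hζ : ζ ∉ K) (hζβ : ζ.im = β) :
    ∑ i ∈ Finset.range n, segIntegral (fun w => F w / (w - ζ)) (p i) (p (i + 1)) =
      -(2 * Real.pi * Complex.I * F ζ) := by
  have hU : IsOpen Kᶜ := hK.isClosed.isOpen_compl
  set q : ℂ → ℂ := fun w => w * F w with hq
  have hqd : DifferentiableOn ℂ q Kᶜ := differentiableOn_id.mul hF
  obtain ⟨C, hC⟩ := exists_norm_dslope_mul_le hU hqd
    (fun z hz => by rw [hq, norm_mul, mul_comm]; exact hM z hz) hζ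
  have hne : ∀ w ∈ Kᶜ, w ≠ 0 := fun w hw h => hw (h ▸ h0)
  have hdil : ∀ z ∈ Kᶜ, ∀ s : ℝ, 1 ≤ s → (s : ℂ) * z ∈ Kᶜ := by
    intro z hz s hs hsz
    refine hz ?_
    have hs0 : (0 : ℝ) < s := by linarith
    have hsC : (s : ℂ) ≠ 0 := by exact_mod_cast hs0.ne'
    have := hconv.smul_mem_of_zero_mem h0 hsz (t := s⁻¹) ⟨by positivity, inv_le_one_of_one_le₀ hs⟩
    rwa [Complex.real_smul, Complex.ofReal_inv, inv_mul_cancel_left₀ hsC] at this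
  obtain ⟨Φ, hΦ, -⟩ := exists_primitive_of_dilation_invariant hU hdil (fun h => h h0)
    (g := fun w => dslope q ζ w / w)
    (((Complex.differentiableOn_dslope (hU.mem_nhds hζ)).2 hqd).div differentiableOn_id hne)
    (M := C) (by
      intro z hz
      have hz0 : 0 < ‖z‖ := norm_pos_iff.2 (hne z hz)
      rw [norm_div]
      calc ‖dslope q ζ z‖ / ‖z‖ * ‖z‖ ^ 2 = ‖dslope q ζ z‖ * ‖z‖ := by field_simp
        _ ≤ C := hC z hz)
  have hseg : ∀ i < n, segIntegral (fun w => F w / (w - ζ)) (p i) (p (i + 1)) =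
      (Φ (p (i + 1)) + F ζ * Complex.log (Complex.I * (p (i + 1) - ζ))) -
      (Φ (p i) + F ζ * Complex.log (Complex.I * (p i - ζ))) -
      F ζ * Complex.log (p (i + 1) / p i) := by
    intro i hi
    have hpi : p i ≠ 0 := by
      intro h
      have := hp.re_div_pos i hi
      simp [h] at this
    have hsubne : ∀ s ∈ Set.Icc (0 : ℝ) 1, segPoint (p i) (p (i + 1)) s - ζ ≠ 0 := by
      intro s hs h
      have h1 := hp.im_lt i hi s hs
      have h2 := congrArg Complex.im h
      rw [Complex.sub_im, Complex.zero_im] at h2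
      linarith
    -- The factor `I` turns the half-plane below `ζ` into the right half-plane, where the principal
    -- logarithm is analytic. The last logarithm is normalized at each vertex, so it is the only
    -- term that does not telescope.
    rw [segIntegral_eq_sub (Φ := fun w => Φ w + F ζ * Complex.log (Complex.I * (w - ζ)) -
      F ζ * Complex.log (w / p i))]
    · simp only [div_self hpi, Complex.log_one, mul_zero, sub_zero]; ring
    · refine ContinuousOn.div ?_ ((continuous_segPoint _ _).continuousOn.sub continuousOn_const)
        hsubne
      exact hF.continuousOn.comp (continuous_segPoint _ _).continuousOn (hp.notMem i hi)
    · intro s hs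
      set w := segPoint (p i) (p (i + 1)) s with hw
      have hwK : w ∈ Kᶜ := hp.notMem i hi s hs
      have hw0 := hne w hwK
      have hwζ : w - ζ ≠ 0 := hsubne s hs
      have d1 : HasDerivAt (fun w => Complex.log (Complex.I * (w - ζ)))
          (Complex.I * 1 / (Complex.I * (w - ζ))) w := by
        refine HasDerivAt.clog (((hasDerivAt_id' w).sub_const ζ).const_mul Complex.I) ?_
        left
        have := hp.im_lt i hi s hs
        simp only [Complex.mul_re, Complex.I_re, Complex.I_im, Complex.sub_im]
        linarith
      have d2 : HasDerivAt (fun w => Complex.log (w / p i)) (1 / p i / (w / p i)) w := by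
        refine HasDerivAt.clog ((hasDerivAt_id' w).div_const (p i)) ?_
        left
        have e : w / p i = ((1 - s : ℝ) : ℂ) + (s : ℝ) * (p (i + 1) / p i) := by
          rw [hw, segPoint]; push_cast; field_simp; ring
        rw [e, Complex.add_re, Complex.ofReal_re, Complex.re_ofReal_mul]
        have := hp.re_div_pos i hi
        rcases hs.1.eq_or_lt with h | h
        · rw [← h]; norm_num
        · have := mul_pos h this
          linarith [hs.2]
      refine (((hΦ w hwK).add (d1.const_mul (F ζ))).sub (d2.const_mul (F ζ))).congr_deriv ?_
      have hd : dslope q ζ w = (w * F w - ζ * F ζ) / (w - ζ) := by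
        rw [dslope_of_ne _ (sub_ne_zero.1 hwζ), slope_def_field]
      rw [hd]
      have := Complex.I_ne_zero
      field_simp
      ring
  rw [Finset.sum_congr rfl fun i hi => hseg i (Finset.mem_range.1 hi), Finset.sum_sub_distrib,
    Finset.sum_range_sub (fun i => Φ (p i) + F ζ * Complex.log (Complex.I * (p i - ζ))),
    ← Finset.mul_sum, hp.sum_log, hp.closed]
  ring

theorem continuous_reflectLine (β : ℝ) : Continuous (reflectLine β) := by
  unfold reflectLine; fun_prop

/-- The conjugate of the half-plane Cauchy formula at the mirror image of `w`: for points on the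
line, conjugation exchanges the differences to `w` and to its mirror image. -/
theorem integral_conj_div_sub_line {b β : ℝ} (hb : 0 ≤ b) (hβ : b < β)
    (hF : DifferentiableOn ℂ F {z | b < z.im}) {M M' : ℝ} (hM : ∀ z : ℂ, b < z.im → ‖F z‖ ≤ M)
    (hM' : ∀ z : ℂ, b < z.im → ‖F z‖ * ‖z‖ ≤ M') {w : ℂ} (hw : w.im < β) :
    ∫ x : ℝ, starRingEnd ℂ (F (x + β * Complex.I)) / (w - (x + β * Complex.I)) =
      2 * Real.pi * Complex.I * starRingEnd ℂ (F (reflectLine β w)) := by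
  have h := cauchy_formula_line hb hβ hF hM hM' (z := reflectLine β w)
    (by rw [reflectLine_im]; linarith)
  have h2 := congrArg (starRingEnd ℂ) h
  rw [← integral_conj] at h2
  have e : ∀ x : ℝ, starRingEnd ℂ (F (x + β * Complex.I)) / (w - (x + β * Complex.I)) =
      -starRingEnd ℂ (F (x + β * Complex.I) / ((x + β * Complex.I) - reflectLine β w)) := by
    intro x
    rw [sub_reflectLine_of_line, map_div₀, Complex.conj_conj, ← div_neg, neg_sub]
  simp_rw [e]
  rw [integral_neg, h2]
  simp only [map_mul, Complex.conj_I, Complex.conj_ofReal, map_ofNat]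
  ring

theorem im_gt_subset_compl {b : ℝ} (hb : ∀ z ∈ K, z.im ≤ b) : {z : ℂ | b < z.im} ⊆ Kᶜ :=
  fun z hz hzK => not_lt.2 (hb z hzK) hz

/-- Cauchy's theorem applied to the product of `F` and its reflection expresses the integral of
`|F|²` over a horizontal line by an integral over a polygon around `K`. -/
theorem IsPolygonAround.sum_segIntegral_mul_reflect (hp : IsPolygonAround K β n p)
    (hK : IsCompact K) (hconv : Convex ℝ K) (h0 : (0 : ℂ) ∈ K) {b : ℝ} (hb0 : 0 ≤ b)
    (hb : ∀ z ∈ K, z.im ≤ b) (hβ : b < β) (hF : DifferentiableOn ℂ F Kᶜ) {M M' : ℝ}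
    (hM : ∀ z ∈ Kᶜ, ‖F z‖ ≤ M) (hM' : ∀ z ∈ Kᶜ, ‖F z‖ * ‖z‖ ≤ M') :
    ∑ i ∈ Finset.range n, segIntegral (fun w => F w * starRingEnd ℂ (F (reflectLine β w)))
        (p i) (p (i + 1)) =
      -((∫ x : ℝ, ‖F (x + β * Complex.I)‖ ^ 2 : ℝ) : ℂ) := by
  have hsub := im_gt_subset_compl hb
  have hβ0 : 0 < β := by linarith
  set ζ : ℝ → ℂ := fun x => x + β * Complex.I with hζ
  have hζim : ∀ x, (ζ x).im = β := fun x => by simp [hζ]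
  have hζK : ∀ x, ζ x ∈ Kᶜ := fun x => hsub (by simpa [hζ] using hβ)
  have hζc : Continuous ζ := by rw [hζ]; fun_prop
  have hFζ : Continuous fun x => F (ζ x) := hF.continuousOn.comp_continuous hζc hζK
  set h : ℕ → ℝ → ℝ → ℂ := fun i x s => starRingEnd ℂ (F (ζ x)) *
    (F (segPoint (p i) (p (i + 1)) s) / (segPoint (p i) (p (i + 1)) s - ζ x) *
      (p (i + 1) - p i)) with hh
  have hint : ∀ i < n, Integrable (Function.uncurry (h i))
      (volume.prod (volume.restrict (Set.Ioc (0 : ℝ) 1))) := by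
    intro i hi
    set w := segPoint (p i) (p (i + 1)) with hw
    have hwc : Continuous w := continuous_segPoint _ _
    have hFw : ContinuousOn (fun s => F (w s)) (Set.Icc 0 1) :=
      hF.continuousOn.comp hwc.continuousOn (hp.notMem i hi)
    obtain ⟨s₀, hs₀, hmax⟩ := isCompact_Icc.exists_isMaxOn (Set.nonempty_Icc.2 zero_le_one)
      ((Complex.continuous_im.comp hwc).continuousOn (s := Set.Icc (0 : ℝ) 1))
    set r := β - (w s₀).im with hr
    have hr0 : 0 < r := sub_pos.2 (hp.im_lt i hi s₀ hs₀)
    have hrle : ∀ s ∈ Set.Icc (0 : ℝ) 1, ∀ x, r ≤ ‖ζ x - w s‖ := by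
      intro s hs x
      have h1 := Complex.abs_im_le_norm (ζ x - w s)
      have h2 : (w s).im ≤ (w s₀).im := hmax hs
      rw [Complex.sub_im, hζim] at h1
      linarith [le_abs_self (β - (w s).im)]
    obtain ⟨W, hW⟩ := isCompact_Icc.bddAbove_image hwc.norm.continuousOn (K := Set.Icc (0 : ℝ) 1)
    have hW' : ∀ s ∈ Set.Icc (0 : ℝ) 1, ‖w s‖ ≤ W := fun s hs => hW ⟨s, hs, rfl⟩
    have hM'0 : 0 ≤ M' := le_trans (by positivity) (hM' _ (hζK 0))
    have hM0 : 0 ≤ M := le_trans (by positivity) (hM _ (hζK 0))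
    -- For Fubini: `F (ζ x)` and the Cauchy kernel each contribute one factor `O(|ζ x|⁻¹)`,
    -- uniformly along the segment.
    refine Integrable.mono' (((integrable_inv_sq_add_sq hβ0).const_mul
      (M' * (M * (1 + W / r) * ‖p (i + 1) - p i‖))).comp_fst _) ?_ ?_
    · have e : (volume : Measure ℝ).prod (volume.restrict (Set.Ioc (0 : ℝ) 1)) =
          (volume.prod volume).restrict (Set.univ ×ˢ Set.Ioc (0 : ℝ) 1) := by
        rw [← Measure.prod_restrict, Measure.restrict_univ]
      rw [e]
      refine ContinuousOn.aestronglyMeasurable ?_ (MeasurableSet.univ.prod measurableSet_Ioc)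
      simp only [hh, Function.uncurry_def]
      have hmaps : Set.MapsTo (Prod.snd : ℝ × ℝ → ℝ) (Set.univ ×ˢ Set.Ioc (0 : ℝ) 1)
          (Set.Icc 0 1) := fun x hx => Set.Ioc_subset_Icc_self hx.2
      refine ContinuousOn.mul ?_ (ContinuousOn.mul (ContinuousOn.div ?_ ?_ ?_) continuousOn_const)
      · exact (Complex.continuous_conj.comp (hFζ.comp continuous_fst)).continuousOn
      · exact hFw.comp continuous_snd.continuousOn hmaps
      · exact ((hwc.comp continuous_snd).sub (hζc.comp continuous_fst)).continuousOn
      · intro x hx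
        have := hrle x.2 (hmaps hx) x.1
        rw [norm_sub_rev] at this
        exact norm_pos_iff.1 (hr0.trans_le this)
    · have hae : ∀ᵐ x ∂((volume : Measure ℝ).prod (volume.restrict (Set.Ioc (0 : ℝ) 1))),
          x.2 ∈ Set.Ioc (0 : ℝ) 1 :=
        Measure.quasiMeasurePreserving_snd.ae (ae_restrict_mem measurableSet_Ioc)
      filter_upwards [hae] with x hx
      have hs : x.2 ∈ Set.Icc (0 : ℝ) 1 := Set.Ioc_subset_Icc_self hx
      have k1 := hM' _ (hζK x.1)
      have k2 := hM _ (hp.notMem i hi x.2 hs)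
      have k3 := norm_le_mul_norm_sub hr0 (hrle x.2 hs x.1)
      have k4 := hr0.trans_le (hrle x.2 hs x.1)
      have k5 := hW' x.2 hs
      have k6 : 0 < ‖ζ x.1‖ := norm_pos_iff.2 fun h => (hζK x.1) (h ▸ h0)
      have k7 : x.1 ^ 2 + β ^ 2 = ‖ζ x.1‖ ^ 2 := (norm_add_mul_I_sq x.1 β).symm
      simp only [hh, Function.uncurry_def, norm_mul, norm_div, RCLike.norm_conj]
      rw [norm_sub_rev (segPoint _ _ _), k7]
      have e1 : ‖F (ζ x.1)‖ ≤ M' * ‖ζ x.1‖⁻¹ := by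
        rw [← div_eq_mul_inv, le_div_iff₀ k6]; exact k1
      have e2 : 1 / ‖ζ x.1 - w x.2‖ ≤ (1 + W / r) * ‖ζ x.1‖⁻¹ := by
        rw [← div_eq_mul_inv, div_le_div_iff₀ k4 k6, one_mul]
        refine k3.trans ?_
        gcongr
      calc _ = ‖F (ζ x.1)‖ * (‖F (w x.2)‖ * (1 / ‖ζ x.1 - w x.2‖) * ‖p (i + 1) - p i‖) := by
            rw [mul_one_div]
        _ ≤ (M' * ‖ζ x.1‖⁻¹) * (M * ((1 + W / r) * ‖ζ x.1‖⁻¹) * ‖p (i + 1) - p i‖) := by gcongr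
        _ = _ := by rw [← inv_pow]; ring
  -- Integrating over the line first, the half-plane formula produces the reflected function at
  -- points of the segment.
  have hswap : ∀ i < n, ∫ x, starRingEnd ℂ (F (ζ x)) *
      segIntegral (fun w => F w / (w - ζ x)) (p i) (p (i + 1)) =
      2 * Real.pi * Complex.I *
        segIntegral (fun w => F w * starRingEnd ℂ (F (reflectLine β w))) (p i) (p (i + 1)) := by
    intro i hi
    calc _ = ∫ x, ∫ s in Set.Ioc (0 : ℝ) 1, h i x s := by
          congr 1; ext x
          rw [segIntegral, intervalIntegral.integral_of_le zero_le_one, ← integral_const_mul]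
      _ = ∫ s in Set.Ioc (0 : ℝ) 1, ∫ x, h i x s := integral_integral_swap (hint i hi)
      _ = ∫ s in Set.Ioc (0 : ℝ) 1, 2 * Real.pi * Complex.I *
            (F (segPoint (p i) (p (i + 1)) s) *
              starRingEnd ℂ (F (reflectLine β (segPoint (p i) (p (i + 1)) s))) *
                (p (i + 1) - p i)) := by
          refine setIntegral_congr_fun measurableSet_Ioc fun s hs => ?_
          have hI := integral_conj_div_sub_line hb0 hβ (hF.mono hsub) (fun z hz => hM z (hsub hz))
            (fun z hz => hM' z (hsub hz)) (hp.im_lt i hi s (Set.Ioc_subset_Icc_self hs))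
          have e : ∀ x, h i x s = (starRingEnd ℂ (F (x + β * Complex.I)) /
              (segPoint (p i) (p (i + 1)) s - (x + β * Complex.I))) *
              (F (segPoint (p i) (p (i + 1)) s) * (p (i + 1) - p i)) := by
            intro x; simp only [hh, hζ]; ring
          simp_rw [e]
          rw [integral_mul_const, hI]
          ring
      _ = _ := by
          rw [integral_const_mul, segIntegral, intervalIntegral.integral_of_le zero_le_one]
  -- Integrating over the polygon first, the exterior formula produces `F (ζ x)`, hence `|F|²`.
  -- Equating the two orders gives the identity.
  have hsum : ∑ i ∈ Finset.range n, ∫ x, starRingEnd ℂ (F (ζ x)) *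
      segIntegral (fun w => F w / (w - ζ x)) (p i) (p (i + 1)) =
      -(2 * Real.pi * Complex.I * ((∫ x : ℝ, ‖F (ζ x)‖ ^ 2 : ℝ) : ℂ)) := by
    rw [← integral_finsetSum]
    · rw [← integral_complex_ofReal, ← integral_const_mul, ← integral_neg]
      congr 1; ext x
      rw [← Finset.mul_sum, hp.segIntegral_cauchy hK hconv h0 hF hM' (hζK x) (hζim x)]
      have := Complex.conj_mul' (F (ζ x))
      push_cast
      rw [← this]
      ring
    · intro i hi
      have := (hint i (Finset.mem_range.1 hi)).integral_prod_left
      refine this.congr (ae_of_all _ fun x => ?_)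
      simp only [hh, Function.uncurry_def]
      rw [segIntegral, intervalIntegral.integral_of_le zero_le_one, integral_const_mul]
  rw [Finset.sum_congr rfl fun i hi => hswap i (Finset.mem_range.1 hi), ← Finset.mul_sum,
    ← mul_neg] at hsum
  exact mul_left_cancel₀ Complex.two_pi_I_ne_zero hsum

end

/-! ### Comparing chords with arcs -/

/-- The distance to `γ a` is 1-Lipschitz and, by the intermediate value theorem, takes every value
up to the chord length on the arc. The half-open interval makes consecutive arcs disjoint. -/
theorem ofReal_dist_le_hausdorffMeasure_image {γ : ℝ → ℂ} {a b : ℝ} (hab : a ≤ b)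
    (hγ : ContinuousOn γ (Set.Icc a b)) :
    ENNReal.ofReal (dist (γ a) (γ b)) ≤ Measure.hausdorffMeasure 1 (γ '' Set.Ioc a b) := by
  have hlip : LipschitzWith 1 fun w : ℂ => dist w (γ a) := LipschitzWith.dist_left (γ a)
  have hsub : Set.Ioc 0 (dist (γ a) (γ b)) ⊆ (fun w => dist w (γ a)) '' (γ '' Set.Ioc a b) := by
    have := intermediate_value_Ioc hab (f := fun t => dist (γ t) (γ a))
      ((continuous_id.dist (continuous_const (y := γ a))).comp_continuousOn hγ)
    rw [Set.image_image]
    simpa [dist_comm (γ b)] using this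
  calc ENNReal.ofReal (dist (γ a) (γ b)) = Measure.hausdorffMeasure 1 (Set.Ioc 0 (dist (γ a) (γ b))) := by
        rw [hausdorffMeasure_real, Real.volume_Ioc, sub_zero]
    _ ≤ _ := measure_mono hsub
    _ ≤ _ := by simpa using hlip.hausdorffMeasure_image_le zero_le_one (γ '' Set.Ioc a b)

/-- Transfers the integral from the dilated chord to the arc `A` without parametrizing `A` by
length: the mean size `k` of the segment integral is below `G v + η` at every `v` of the arc, and
the arc is at least as long as the chord. -/
theorem enorm_segIntegral_le {g : ℂ → ℂ} {G : ℂ → ℝ≥0∞} {a b : ℂ} {t η : ℝ} (ht : 0 < t)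
    {A : Set ℂ} (hA : MeasurableSet A)
    (hlen : ENNReal.ofReal (dist a b) ≤ Measure.hausdorffMeasure 1 A)
    (hg : ∀ v ∈ A, ∀ s ∈ Set.Icc (0 : ℝ) 1,
      ‖g (segPoint (t * a) (t * b) s)‖ₑ ≤ G v + ENNReal.ofReal η) :
    ‖segIntegral g (t * a) (t * b)‖ₑ ≤
      ENNReal.ofReal t * ∫⁻ v in A, (G v + ENNReal.ofReal η) ∂Measure.hausdorffMeasure 1 := by
  rcases eq_or_ne a b with rfl | hab
  · simp [segIntegral]
  have hd : 0 < dist a b := dist_pos.2 hab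
  set k : ℝ := ‖segIntegral g (t * a) (t * b)‖ / (t * dist a b) with hk
  have hkA : ∀ v ∈ A, ENNReal.ofReal k ≤ G v + ENNReal.ofReal η := by
    intro v hv
    rcases eq_or_ne (G v + ENNReal.ofReal η) ∞ with h | h
    · rw [h]; exact le_top
    rw [← ENNReal.ofReal_toReal h]
    apply ENNReal.ofReal_le_ofReal
    rw [hk, div_le_iff₀ (by positivity)]
    have hbound : ∀ s ∈ Set.uIoc (0 : ℝ) 1, ‖g (segPoint (t * a) (t * b) s) * (t * b - t * a)‖ ≤
        (G v + ENNReal.ofReal η).toReal * (t * dist a b) := by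
      intro s hs
      rw [Set.uIoc_of_le zero_le_one] at hs
      have h1 := hg v hv s (Set.Ioc_subset_Icc_self hs)
      rw [← ofReal_norm, ENNReal.ofReal_le_iff_le_toReal h] at h1
      rw [norm_mul, ← mul_sub, norm_mul, Complex.norm_real, Real.norm_of_nonneg ht.le,
        ← dist_eq_norm, dist_comm b]
      gcongr
    simpa [segIntegral] using intervalIntegral.norm_integral_le_of_norm_le_const hbound
  calc ‖segIntegral g (t * a) (t * b)‖ₑ = ENNReal.ofReal t * (ENNReal.ofReal k * ENNReal.ofReal (dist a b)) := by
        rw [← ENNReal.ofReal_mul (by positivity), ← ENNReal.ofReal_mul ht.le, ← ofReal_norm, hk]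
        congr 1
        field_simp
    _ ≤ ENNReal.ofReal t * (ENNReal.ofReal k * Measure.hausdorffMeasure 1 A) := by gcongr
    _ = ENNReal.ofReal t * ∫⁻ v in A, ENNReal.ofReal k ∂Measure.hausdorffMeasure 1 := by
        rw [setLIntegral_const]
    _ ≤ _ := mul_le_mul_right (setLIntegral_mono' hA hkA) _

/-! ### The boundary as a curve, and the contour moved onto it -/

section Boundary

variable {K : Set ℂ}

/-- The boundary of a convex neighbourhood `K` of the origin, parametrized by the argument. -/
noncomputable def gaugeCurve (K : Set ℂ) (θ : ℝ) : ℂ :=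
  ((gauge K (Complex.exp (θ * Complex.I)))⁻¹ : ℝ) * Complex.exp (θ * Complex.I)

theorem gauge_exp_pos (hK : IsCompact K) (h0 : K ∈ 𝓝 (0 : ℂ)) (θ : ℝ) :
    0 < gauge K (Complex.exp (θ * Complex.I)) :=
  (gauge_pos (absorbent_nhds_zero h0) (NormedSpace.isVonNBounded_of_isBounded ℝ hK.isBounded)).2
    (Complex.exp_ne_zero _)

theorem gauge_ofReal_mul (t : ℝ) (ht : 0 ≤ t) (z : ℂ) : gauge K (t * z) = t * gauge K z := by
  rw [← Complex.real_smul, gauge_smul_of_nonneg ht, smul_eq_mul]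

theorem gauge_gaugeCurve (hK : IsCompact K) (h0 : K ∈ 𝓝 (0 : ℂ)) (θ : ℝ) :
    gauge K (gaugeCurve K θ) = 1 := by
  have h := gauge_exp_pos hK h0 θ
  rw [gaugeCurve, gauge_ofReal_mul _ (inv_nonneg.2 h.le), inv_mul_cancel₀ h.ne']

theorem gaugeCurve_mem_frontier (hK : IsCompact K) (hconv : Convex ℝ K) (h0 : K ∈ 𝓝 (0 : ℂ))
    (θ : ℝ) : gaugeCurve K θ ∈ frontier K :=
  (gauge_eq_one_iff_mem_frontier hconv h0).1 (gauge_gaugeCurve hK h0 θ)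

theorem continuous_gaugeCurve (hK : IsCompact K) (hconv : Convex ℝ K) (h0 : K ∈ 𝓝 (0 : ℂ)) :
    Continuous (gaugeCurve K) := by
  have hg : Continuous fun θ : ℝ => gauge K (Complex.exp (θ * Complex.I)) :=
    (continuous_gauge hconv h0).comp (by fun_prop)
  have := hg.inv₀ fun θ => (gauge_exp_pos hK h0 θ).ne'
  exact (Complex.continuous_ofReal.comp this).mul (by fun_prop)

theorem arg_gaugeCurve (hK : IsCompact K) (h0 : K ∈ 𝓝 (0 : ℂ)) {θ : ℝ}
    (hθ : θ ∈ Set.Ioc (-Real.pi) Real.pi) : (gaugeCurve K θ).arg = θ := by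
  have h := inv_pos.2 (gauge_exp_pos hK h0 θ)
  rw [gaugeCurve]
  generalize (gauge K (Complex.exp (θ * Complex.I)))⁻¹ = ρ at h ⊢
  rw [Complex.exp_mul_I]
  exact Complex.arg_mul_cos_add_sin_mul_I h hθ

theorem injOn_gaugeCurve (hK : IsCompact K) (h0 : K ∈ 𝓝 (0 : ℂ)) :
    Set.InjOn (gaugeCurve K) (Set.Ioc (-Real.pi) Real.pi) := by
  intro x hx y hy h
  rw [← arg_gaugeCurve hK h0 hx, h, arg_gaugeCurve hK h0 hy]

theorem gaugeCurve_neg_pi : gaugeCurve K (-Real.pi) = gaugeCurve K Real.pi := by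
  simp [gaugeCurve, Complex.exp_neg]

theorem gaugeCurve_div (hK : IsCompact K) (h0 : K ∈ 𝓝 (0 : ℂ)) (θ θ' : ℝ) :
    gaugeCurve K θ' / gaugeCurve K θ =
      ((gauge K (Complex.exp (θ * Complex.I)) / gauge K (Complex.exp (θ' * Complex.I)) : ℝ) : ℂ) *
        Complex.exp ((θ' - θ : ℝ) * Complex.I) := by
  have h := (gauge_exp_pos hK h0 θ).ne'
  have h' := (gauge_exp_pos hK h0 θ').ne'
  have hC : ((gauge K (Complex.exp (θ * Complex.I)) : ℝ) : ℂ) ≠ 0 := by exact_mod_cast h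
  have hC' : ((gauge K (Complex.exp (θ' * Complex.I)) : ℝ) : ℂ) ≠ 0 := by exact_mod_cast h'
  have he := Complex.exp_ne_zero (θ * Complex.I)
  simp only [gaugeCurve]
  push_cast
  rw [sub_mul, Complex.exp_sub]
  field_simp

/-- The `i`-th of the `n + 1` equally spaced arguments in `[-π, π]`. -/
noncomputable def equiArg (n i : ℕ) : ℝ := -Real.pi + i * (2 * Real.pi / n)

theorem equiArg_succ_sub (n i : ℕ) : equiArg n (i + 1) - equiArg n i = 2 * Real.pi / n := by
  simp only [equiArg]; push_cast; ring

theorem equiArg_mono (n : ℕ) : Monotone (equiArg n) := by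
  intro i j h
  have := Real.pi_pos
  unfold equiArg
  gcongr

theorem equiArg_zero (n : ℕ) : equiArg n 0 = -Real.pi := by simp [equiArg]

theorem equiArg_self {n : ℕ} (hn : n ≠ 0) : equiArg n n = Real.pi := by
  simp only [equiArg]; field_simp; ring

theorem segPoint_mem_of_convex {S : Set ℂ} (hS : Convex ℝ S) {a b : ℂ} (ha : a ∈ S) (hb : b ∈ S)
    {s : ℝ} (hs : s ∈ Set.Icc (0 : ℝ) 1) : segPoint a b s ∈ S := by
  have := hS.add_smul_sub_mem ha hb hs
  rwa [Complex.real_smul] at this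

/-- The vertices have gauge `1 + τ`, and along an edge the gauge falls by less than `τ` because the
edges are shorter than `r τ`; so the edges miss `K`. Five or more vertices keep each angular step
below `π/2`. In the sum of logarithms the moduli telescope and the arguments add up to `2π`. -/
theorem isPolygonAround_gaugeCurve (hK : IsCompact K) (hconv : Convex ℝ K) {r : ℝ} (hr : 0 < r)
    (hball : Metric.ball 0 r ⊆ K) {b β τ : ℝ} (hb : ∀ z ∈ K, z.im ≤ b) (hτ : 0 < τ)
    (hβ : (1 + τ) * b < β) {n : ℕ} (hn : 5 ≤ n)
    (hmesh : ∀ i < n, (1 + τ) *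
      dist (gaugeCurve K (equiArg n i)) (gaugeCurve K (equiArg n (i + 1))) < r * τ) :
    IsPolygonAround K β n fun i => ((1 + τ : ℝ) : ℂ) * gaugeCurve K (equiArg n i) := by
  have h0 : K ∈ 𝓝 (0 : ℂ) := Filter.mem_of_superset (Metric.ball_mem_nhds _ hr) hball
  have ht : (0 : ℝ) < 1 + τ := by linarith
  have htC : ((1 + τ : ℝ) : ℂ) ≠ 0 := by exact_mod_cast ht.ne'
  have hγK : ∀ θ, gaugeCurve K θ ∈ K := fun θ =>
    hK.isClosed.frontier_subset (gaugeCurve_mem_frontier hK hconv h0 θ)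
  have hn0 : (0 : ℝ) < n := by exact_mod_cast (by omega : 0 < n)
  have hn5 : (5 : ℝ) ≤ n := by exact_mod_cast hn
  have hpi := Real.pi_pos
  have hδ : 2 * Real.pi / n < Real.pi / 2 := by
    rw [div_lt_div_iff₀ hn0 two_pos]; nlinarith
  have hδ0 : 0 < 2 * Real.pi / n := by positivity
  have hdiv : ∀ i, ((1 + τ : ℝ) : ℂ) * gaugeCurve K (equiArg n (i + 1)) /
      (((1 + τ : ℝ) : ℂ) * gaugeCurve K (equiArg n i)) =
      ((gauge K (Complex.exp (equiArg n i * Complex.I)) /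
        gauge K (Complex.exp (equiArg n (i + 1) * Complex.I)) : ℝ) : ℂ) *
        Complex.exp ((2 * Real.pi / n : ℝ) * Complex.I) := by
    intro i
    rw [mul_div_mul_left _ _ htC, gaugeCurve_div hK h0, equiArg_succ_sub]
  have him : (((2 * Real.pi / n : ℝ) : ℂ) * Complex.I).im = 2 * Real.pi / n := by
    rw [Complex.im_ofReal_mul, Complex.I_im, mul_one]
  have hgpos : ∀ i, 0 < gauge K (Complex.exp (equiArg n i * Complex.I)) :=
    fun i => gauge_exp_pos hK h0 _
  constructor
  · simp only [equiArg_zero, equiArg_self (show n ≠ 0 by omega), gaugeCurve_neg_pi]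
  · intro i hi s hs hmem
    set p := ((1 + τ : ℝ) : ℂ) * gaugeCurve K (equiArg n i) with hp
    set p' := ((1 + τ : ℝ) : ℂ) * gaugeCurve K (equiArg n (i + 1)) with hp'
    have h1 : gauge K p = 1 + τ := by
      rw [hp, gauge_ofReal_mul _ ht.le, gauge_gaugeCurve hK h0, mul_one]
    have h2 := gauge_add_le hconv (absorbent_nhds_zero h0) (segPoint p p' s) (p - segPoint p p' s)
    rw [add_sub_cancel, h1] at h2
    have h3 := gauge_le_one_of_mem hmem
    have h4 : r * gauge K (p - segPoint p p' s) ≤ ‖p - segPoint p p' s‖ := mul_gauge_le_norm hball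
    have h5 : ‖p - segPoint p p' s‖ ≤
        (1 + τ) * dist (gaugeCurve K (equiArg n i)) (gaugeCurve K (equiArg n (i + 1))) := by
      have e : p - segPoint p p' s = s * (((1 + τ : ℝ) : ℂ) *
          (gaugeCurve K (equiArg n i) - gaugeCurve K (equiArg n (i + 1)))) := by
        rw [segPoint, hp, hp']; ring
      rw [e, norm_mul, norm_mul, Complex.norm_real, Complex.norm_real, Real.norm_of_nonneg hs.1,
        Real.norm_of_nonneg ht.le, ← dist_eq_norm]
      exact mul_le_of_le_one_left (by positivity) hs.2
    have h6 := hmesh i hi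
    nlinarith
  · intro i hi s hs
    refine lt_of_le_of_lt ?_ hβ
    have : ∀ j, ((1 + τ : ℝ) : ℂ) * gaugeCurve K (equiArg n j) ∈ {z : ℂ | z.im ≤ (1 + τ) * b} := by
      intro j
      simp only [Set.mem_ofPred_eq, Complex.im_ofReal_mul]
      exact mul_le_mul_of_nonneg_left (hb _ (hγK _)) ht.le
    exact segPoint_mem_of_convex (convex_halfSpace_im_le _) (this i) (this (i + 1)) hs
  · intro i hi
    rw [hdiv, Complex.re_ofReal_mul, Complex.exp_ofReal_mul_I_re]
    exact mul_pos (div_pos (hgpos _) (hgpos _))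
      (Real.cos_pos_of_mem_Ioo ⟨by linarith, hδ⟩)
  · have hlog : ∀ i ∈ Finset.range n, Complex.log (((1 + τ : ℝ) : ℂ) *
        gaugeCurve K (equiArg n (i + 1)) / (((1 + τ : ℝ) : ℂ) * gaugeCurve K (equiArg n i))) =
        -(((Real.log (gauge K (Complex.exp (equiArg n (i + 1) * Complex.I))) : ℝ) : ℂ) -
          ((Real.log (gauge K (Complex.exp (equiArg n i * Complex.I))) : ℝ) : ℂ)) +
          (2 * Real.pi / n : ℝ) * Complex.I := by
      intro i _
      rw [hdiv, Complex.log_ofReal_mul (div_pos (hgpos _) (hgpos _)) (Complex.exp_ne_zero _),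
        Complex.log_exp (by rw [him]; linarith) (by rw [him]; linarith),
        Real.log_div (hgpos _).ne' (hgpos _).ne']
      push_cast
      ring
    rw [Finset.sum_congr rfl hlog, Finset.sum_add_distrib, Finset.sum_neg_distrib,
      Finset.sum_range_sub (fun i =>
        ((Real.log (gauge K (Complex.exp (equiArg n i * Complex.I))) : ℝ) : ℂ)),
      Finset.sum_const, Finset.card_range, equiArg_zero, equiArg_self (show n ≠ 0 by omega)]
    have hnC : (n : ℂ) ≠ 0 := by exact_mod_cast hn0.ne'
    have e : Complex.exp (((-Real.pi : ℝ) : ℂ) * Complex.I) =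
        Complex.exp ((Real.pi : ℂ) * Complex.I) := by
      simp [Complex.exp_neg]
    rw [e, sub_self, neg_zero, zero_add, nsmul_eq_mul]
    push_cast
    field_simp

/-- A discretized form of the reflection inequality. -/
theorem ofReal_integral_line_sq_le_add (hK : IsCompact K) (hconv : Convex ℝ K)
    (h0 : K ∈ 𝓝 (0 : ℂ)) {b β : ℝ} (hb0 : 0 ≤ b) (hb : ∀ z ∈ K, z.im ≤ b) (hβ : b < β)
    {F : ℂ → ℂ} (hF : IsRegularOutside K F) {η : ℝ} (hη : 0 < η) :
    ENNReal.ofReal (∫ x : ℝ, ‖F (x + β * Complex.I)‖ ^ 2) ≤ ENNReal.ofReal (1 + η) *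
      ((∫⁻ w, ‖F w‖ₑ * ‖F (reflectLine β w)‖ₑ ∂arcLength (frontier K)) +
        ENNReal.ofReal η * Measure.hausdorffMeasure 1 (frontier K)) := by
  obtain ⟨r, hr, hball⟩ := Metric.mem_nhds_iff.1 h0
  obtain ⟨R₀, hR₀⟩ := hK.isBounded.subset_closedBall 0
  set R := max R₀ 1
  have hR1 : 0 < R := lt_of_lt_of_le one_pos (le_max_right _ _)
  have hR : ∀ z ∈ K, ‖z‖ ≤ R := fun z hz =>
    (mem_closedBall_zero_iff.1 (hR₀ hz)).trans (le_max_left _ _)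
  have h0K : (0 : ℂ) ∈ K := mem_of_mem_nhds h0
  have hsub := im_gt_subset_compl hb
  obtain ⟨M', hM'⟩ := hF.exists_norm_mul_le hK
  have hM'K : ∀ z ∈ Kᶜ, ‖F z‖ * ‖z‖ ≤ M' := fun z hz => hM' z (subset_closure hz)
  have hM : ∀ z ∈ Kᶜ, ‖F z‖ ≤ M' / r := by
    intro z hz
    have hrz : r ≤ ‖z‖ := by
      by_contra h
      exact hz (hball (by simpa using not_le.1 h))
    rw [le_div_iff₀ hr]
    exact (by gcongr : ‖F z‖ * r ≤ ‖F z‖ * ‖z‖).trans (hM'K z hz)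
  -- A compact set containing both `Γ` and every polygon used (as `1 + τ ≤ 2`), on which the
  -- integrand `G` is uniformly continuous.
  set Q : Set ℂ := (closure Kᶜ ∩ {z | z.im ≤ β}) ∩ Metric.closedBall 0 (2 * R) with hQ
  have hQc : IsCompact Q := (isCompact_closedBall _ _).inter_left
    (isClosed_closure.inter (isClosed_le Complex.continuous_im continuous_const))
  set G : ℂ → ℝ := fun w => ‖F w‖ * ‖F (reflectLine β w)‖ with hG
  have hrefl : ∀ w : ℂ, w.im ≤ β → reflectLine β w ∈ Kᶜ := by
    intro w hw
    apply hsub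
    rw [Set.mem_ofPred_eq, reflectLine_im]; linarith
  have hGc : ContinuousOn G Q := by
    refine ContinuousOn.mul (hF.continuousOn.mono fun w hw => hw.1.1).norm ?_
    exact (hF.differentiableOn.continuousOn.comp (continuous_reflectLine β).continuousOn
      fun w hw => hrefl w hw.1.2).norm
  obtain ⟨δ, hδ, hδG⟩ := Metric.uniformContinuousOn_iff.1
    (hQc.uniformContinuousOn_of_continuous hGc) η hη
  obtain ⟨τ, hτ0, hτ⟩ : ∃ τ > 0, τ ≤ 1 ∧ τ ≤ η ∧ τ * R < δ / 3 ∧ (1 + τ) * b < β := by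
    have hev : ∀ᶠ τ : ℝ in 𝓝 0, τ ≤ 1 ∧ τ ≤ η ∧ τ * R < δ / 3 ∧ (1 + τ) * b < β := by
      refine (eventually_le_nhds one_pos).and ((eventually_le_nhds hη).and
        (Filter.Eventually.and ?_ ?_))
      · have : Tendsto (fun τ : ℝ => τ * R) (𝓝 0) (𝓝 (0 * R)) := tendsto_id.mul_const R
        exact this.eventually_lt_const (by rw [zero_mul]; positivity)
      · have : Tendsto (fun τ : ℝ => (1 + τ) * b) (𝓝 0) (𝓝 ((1 + 0) * b)) :=
          (tendsto_const_nhds.add tendsto_id).mul_const b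
        exact this.eventually_lt_const (by simpa using hβ)
    obtain ⟨τ, h1, h2⟩ := ((hev.filter_mono nhdsWithin_le_nhds).and
      (self_mem_nhdsWithin (s := Set.Ioi (0 : ℝ)))).exists
    exact ⟨τ, h2, h1⟩
  obtain ⟨hτ1, hτη, hτR, hτβ⟩ := hτ
  set γ := gaugeCurve K with hγ
  have hγc : Continuous γ := continuous_gaugeCurve hK hconv h0
  have hγΓ : ∀ θ, γ θ ∈ frontier K := gaugeCurve_mem_frontier hK hconv h0
  have hγK : ∀ θ, γ θ ∈ K := fun θ => hK.isClosed.frontier_subset (hγΓ θ)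
  -- A point of an edge is within `τ R + 2ρ` of the arc's starting point, hence within `τ R + 3ρ <
  -- δ` of any point of the arc. The bound `r τ / 2` keeps the dilated edges shorter than `r τ`.
  set ρ := min (δ / 6) (r * τ / 2) with hρ
  have hρ0 : 0 < ρ := by positivity
  obtain ⟨μ, hμ, hμγ⟩ := Metric.uniformContinuousOn_iff.1
    ((isCompact_Icc (a := -Real.pi) (b := Real.pi)).uniformContinuousOn_of_continuous
      hγc.continuousOn) ρ hρ0
  obtain ⟨n, hn5, hnμ⟩ : ∃ n : ℕ, 5 ≤ n ∧ 2 * Real.pi / n < μ := by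
    have := (tendsto_const_div_atTop_nhds_zero_nat (2 * Real.pi)).eventually_lt_const hμ
    exact ((eventually_ge_atTop 5).and this).exists
  have hn0 : n ≠ 0 := by omega
  have hargmem : ∀ i ≤ n, equiArg n i ∈ Set.Icc (-Real.pi) Real.pi := by
    intro i hi
    constructor
    · rw [← equiArg_zero n]; exact equiArg_mono n (Nat.zero_le _)
    · rw [← equiArg_self hn0]; exact equiArg_mono n hi
  have hclose : ∀ i < n, ∀ θ ∈ Set.Icc (equiArg n i) (equiArg n (i + 1)),
      dist (γ (equiArg n i)) (γ θ) < ρ := by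
    intro i hi θ hθ
    refine hμγ _ (hargmem i hi.le) _ ⟨(hargmem i hi.le).1.trans hθ.1,
      hθ.2.trans (hargmem (i + 1) hi).2⟩ ?_
    have := equiArg_succ_sub n i
    rw [Real.dist_eq, abs_sub_comm, abs_of_nonneg (by linarith [hθ.1])]
    linarith [hθ.2]
  have hchord : ∀ i < n, dist (γ (equiArg n i)) (γ (equiArg n (i + 1))) < ρ := fun i hi =>
    hclose i hi _ ⟨equiArg_mono n (Nat.le_succ i), le_rfl⟩
  have hpoly := isPolygonAround_gaugeCurve hK hconv hr hball hb hτ0 hτβ hn5 (by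
    intro i hi
    have h1 := hchord i hi
    have h2 := min_le_right (δ / 6) (r * τ / 2)
    have h3 : 0 ≤ dist (γ (equiArg n i)) (γ (equiArg n (i + 1))) := dist_nonneg
    calc (1 + τ) * dist (γ (equiArg n i)) (γ (equiArg n (i + 1)))
        ≤ 2 * dist (γ (equiArg n i)) (γ (equiArg n (i + 1))) := by gcongr; linarith
      _ < r * τ := by linarith)
  have hid := hpoly.sum_segIntegral_mul_reflect hK hconv h0K hb0 hb hβ hF.differentiableOn hM hM'K
  have ht : (0 : ℝ) < 1 + τ := by linarith
  set A : ℕ → Set ℂ := fun i => γ '' Set.Ioc (equiArg n i) (equiArg n (i + 1)) with hA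
  have hIocsub : ∀ i < n, Set.Ioc (equiArg n i) (equiArg n (i + 1)) ⊆
      Set.Ioc (-Real.pi) Real.pi := fun i hi =>
    Set.Ioc_subset_Ioc (hargmem i hi.le).1 (hargmem (i + 1) hi).2
  have hinj := injOn_gaugeCurve hK h0
  have hAm : ∀ i < n, MeasurableSet (A i) := fun i hi =>
    measurableSet_Ioc.image_of_continuousOn_injOn hγc.continuousOn (hinj.mono (hIocsub i hi))
  have hAdisj : (↑(Finset.range n) : Set ℕ).PairwiseDisjoint A := by
    intro i hi j hj hij
    rw [Finset.coe_range, Set.mem_Iio] at hi hj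
    exact ((equiArg_mono n).pairwise_disjoint_on_Ioc_succ hij).image hinj (hIocsub i hi)
      (hIocsub j hj)
  have hseg : ∀ i < n, ‖segIntegral (fun w => F w * starRingEnd ℂ (F (reflectLine β w)))
      (((1 + τ : ℝ) : ℂ) * γ (equiArg n i)) (((1 + τ : ℝ) : ℂ) * γ (equiArg n (i + 1)))‖ₑ ≤
      ENNReal.ofReal (1 + τ) * ∫⁻ v in A i, (‖F v‖ₑ * ‖F (reflectLine β v)‖ₑ + ENNReal.ofReal η)
        ∂Measure.hausdorffMeasure 1 := by
    intro i hi
    refine enorm_segIntegral_le ht (hAm i hi) (ofReal_dist_le_hausdorffMeasure_image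
      (equiArg_mono n (Nat.le_succ i)) hγc.continuousOn) ?_
    rintro _ ⟨θ, hθ, rfl⟩ s hs
    set w := segPoint (((1 + τ : ℝ) : ℂ) * γ (equiArg n i))
      (((1 + τ : ℝ) : ℂ) * γ (equiArg n (i + 1))) s with hw
    have hwQ : w ∈ Q := by
      refine ⟨⟨subset_closure (hpoly.notMem i hi s hs), (hpoly.im_lt i hi s hs).le⟩, ?_⟩
      refine segPoint_mem_of_convex (convex_closedBall _ _) ?_ ?_ hs
      all_goals
        rw [mem_closedBall_zero_iff, norm_mul, Complex.norm_real, Real.norm_of_nonneg ht.le]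
        have := hR _ (hγK (equiArg n i))
        have := hR _ (hγK (equiArg n (i + 1)))
        gcongr
        linarith
    have hvQ : γ θ ∈ Q := by
      refine ⟨⟨?_, (hb _ (hγK θ)).trans hβ.le⟩, ?_⟩
      · exact (frontier_eq_closure_inter_closure (s := K) ▸ hγΓ θ).2
      · rw [mem_closedBall_zero_iff]; linarith [hR _ (hγK θ)]
    have hdist : dist w (γ θ) < δ := by
      have d1 : dist w (γ (equiArg n i)) ≤ τ * R + 2 * ρ := by
        have e : w - γ (equiArg n i) = (τ : ℂ) * γ (equiArg n i) + (s : ℂ) * (((1 + τ : ℝ) : ℂ) *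
            (γ (equiArg n (i + 1)) - γ (equiArg n i))) := by
          rw [hw, segPoint]; push_cast; ring
        rw [dist_eq_norm, e]
        refine (norm_add_le _ _).trans ?_
        have h1 := hchord i hi
        rw [dist_comm, dist_eq_norm] at h1
        rw [norm_mul, norm_mul, norm_mul, Complex.norm_real, Complex.norm_real, Complex.norm_real,
          Real.norm_of_nonneg hs.1, Real.norm_of_nonneg ht.le, Real.norm_of_nonneg hτ0.le]
        have h2 := hR _ (hγK (equiArg n i))
        have h3 : s * ((1 + τ) * ‖γ (equiArg n (i + 1)) - γ (equiArg n i)‖) ≤ 1 * (2 * ρ) := by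
          gcongr
          · exact hs.2
          · linarith
        rw [one_mul] at h3
        gcongr
      have d2 := hclose i hi θ ⟨hθ.1.le, hθ.2⟩
      have d3 := min_le_left (δ / 6) (r * τ / 2)
      have := dist_triangle w (γ (equiArg n i)) (γ θ)
      linarith
    have hlt := hδG _ hwQ _ hvQ hdist
    rw [Real.dist_eq] at hlt
    have hle : G w ≤ G (γ θ) + η := by linarith [le_abs_self (G w - G (γ θ))]
    have e1 : ∀ z, ‖F z‖ₑ * ‖F (reflectLine β z)‖ₑ = ENNReal.ofReal (G z) := by
      intro z
      rw [hG, ENNReal.ofReal_mul (norm_nonneg _), ofReal_norm, ofReal_norm]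
    rw [enorm_mul, RCLike.enorm_conj, e1, e1, ← ENNReal.ofReal_add (by positivity) hη.le]
    exact ENNReal.ofReal_le_ofReal hle
  calc ENNReal.ofReal (∫ x : ℝ, ‖F (x + β * Complex.I)‖ ^ 2)
      = ‖∑ i ∈ Finset.range n, segIntegral (fun w => F w * starRingEnd ℂ (F (reflectLine β w)))
        (((1 + τ : ℝ) : ℂ) * γ (equiArg n i)) (((1 + τ : ℝ) : ℂ) * γ (equiArg n (i + 1)))‖ₑ := by
        rw [hid, enorm_neg, ← ofReal_norm, Complex.norm_real, Real.norm_of_nonneg]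
        exact integral_nonneg fun x => by positivity
    _ ≤ ∑ i ∈ Finset.range n, ‖segIntegral (fun w => F w * starRingEnd ℂ (F (reflectLine β w)))
        (((1 + τ : ℝ) : ℂ) * γ (equiArg n i)) (((1 + τ : ℝ) : ℂ) * γ (equiArg n (i + 1)))‖ₑ :=
        enorm_sum_le _ _
    _ ≤ ∑ i ∈ Finset.range n, ENNReal.ofReal (1 + τ) *
        ∫⁻ v in A i, (‖F v‖ₑ * ‖F (reflectLine β v)‖ₑ + ENNReal.ofReal η)
          ∂Measure.hausdorffMeasure 1 :=
        Finset.sum_le_sum fun i hi => hseg i (Finset.mem_range.1 hi)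
    _ = ENNReal.ofReal (1 + τ) * ∫⁻ v in ⋃ i ∈ Finset.range n, A i,
        (‖F v‖ₑ * ‖F (reflectLine β v)‖ₑ + ENNReal.ofReal η) ∂Measure.hausdorffMeasure 1 := by
        rw [← Finset.mul_sum,
          lintegral_biUnion_finset hAdisj fun i hi => hAm i (Finset.mem_range.1 hi)]
    _ ≤ ENNReal.ofReal (1 + η) * ∫⁻ v, (‖F v‖ₑ * ‖F (reflectLine β v)‖ₑ + ENNReal.ofReal η)
          ∂arcLength (frontier K) := by
        refine mul_le_mul' (ENNReal.ofReal_le_ofReal (by linarith))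
          (lintegral_mono' (Measure.restrict_mono ?_ le_rfl) le_rfl)
        refine Set.iUnion₂_subset fun i _ => ?_
        rintro _ ⟨θ, _, rfl⟩
        exact hγΓ θ
    _ = _ := by
        rw [lintegral_add_right _ measurable_const, lintegral_const, arcLength,
          Measure.restrict_apply_univ]

theorem ofReal_integral_line_sq_le (hK : IsCompact K) (hconv : Convex ℝ K)
    (h0 : K ∈ 𝓝 (0 : ℂ)) {b β : ℝ} (hb0 : 0 ≤ b) (hb : ∀ z ∈ K, z.im ≤ b) (hβ : b < β)
    (hlen : Measure.hausdorffMeasure 1 (frontier K) ≠ ∞)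
    {F : ℂ → ℂ} (hF : IsRegularOutside K F) :
    ENNReal.ofReal (∫ x : ℝ, ‖F (x + β * Complex.I)‖ ^ 2) ≤
      ∫⁻ w, ‖F w‖ₑ * ‖F (reflectLine β w)‖ₑ ∂arcLength (frontier K) := by
  set X := ∫⁻ w, ‖F w‖ₑ * ‖F (reflectLine β w)‖ₑ ∂arcLength (frontier K)
  rcases eq_or_ne X ∞ with h | h
  · rw [h]; exact le_top
  have hid : Tendsto (fun η : ℝ => η) (𝓝[>] 0) (𝓝 0) := nhdsWithin_le_nhds
  have hη := ENNReal.tendsto_ofReal hid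
  have h1 := ENNReal.tendsto_ofReal (hid.const_add 1)
  rw [ENNReal.ofReal_zero] at hη
  rw [add_zero, ENNReal.ofReal_one] at h1
  have h2 : Tendsto (fun η : ℝ => X + ENNReal.ofReal η * Measure.hausdorffMeasure 1 (frontier K))
      (𝓝[>] 0) (𝓝 (X + 0 * Measure.hausdorffMeasure 1 (frontier K))) :=
    tendsto_const_nhds.add (ENNReal.Tendsto.mul_const hη (Or.inr hlen))
  rw [zero_mul, add_zero] at h2
  have h3 := ENNReal.Tendsto.mul h1 (Or.inr h) h2 (Or.inr ENNReal.one_ne_top)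
  rw [one_mul] at h3
  refine ge_of_tendsto h3 ?_
  filter_upwards [self_mem_nhdsWithin] with η hη
  exact ofReal_integral_line_sq_le_add hK hconv h0 hb0 hb hβ hF hη

end Boundary

/-! ### Pieces of a convex curve over the coordinate axes -/

/-- On `S` the map `φ` has a 2-Lipschitz inverse, which at most doubles one-dimensional Hausdorff
measure. `S` itself need not be measurable. -/
theorem map_arcLength_le {S : Set ℂ} {φ : ℂ → ℝ} (hφ : Measurable φ)
    (hS : ∀ z ∈ S, ∀ w ∈ S, dist z w ≤ 2 * |φ z - φ w|) :
    (arcLength S).map φ ≤ (2 : ℝ≥0∞) • volume := by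
  refine Measure.le_iff.2 fun B hB => ?_
  rw [Measure.map_apply hφ hB, arcLength, Measure.restrict_apply (hφ hB)]
  set T := φ ⁻¹' B ∩ S with hT
  have hanti : AntilipschitzWith 2 fun x : T => φ x :=
    AntilipschitzWith.of_le_mul_dist fun x y => hS x x.2.2 y y.2.2
  have h1 := hanti.le_hausdorffMeasure_image zero_le_one Set.univ
  have h2 := (isometry_subtype_coe (s := T)).hausdorffMeasure_image (Or.inl zero_le_one) Set.univ
  rw [Set.image_univ, Subtype.range_coe] at h2
  rw [h2]
  calc _ ≤ _ := h1
    _ ≤ (2 : ℝ≥0∞) * volume B := by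
        rw [hausdorffMeasure_real, ENNReal.rpow_one]
        refine mul_le_mul_right (measure_mono ?_) _
        rintro _ ⟨x, -, rfl⟩
        exact x.2.1
    _ = _ := by simp

theorem IsRegularOutside.continuousOn_frontier {K : Set ℂ} {F : ℂ → ℂ}
    (hF : IsRegularOutside K F) : ContinuousOn F (frontier K) := by
  refine hF.continuousOn.mono ?_
  rw [frontier_eq_closure_inter_closure]
  exact Set.inter_subset_right

section Pieces

variable {K : Set ℂ}

/-- A chord between two points of `S` lies on the inner side of the supporting line at each end.
Since the normals make at most `45°` with the `β` axis, the slope of the chord is at most one in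
either direction. -/
theorem abs_sub_le_of_normals {S : Set ℂ} {α β : ℂ → ℝ}
    (h : ∀ p ∈ S, ∃ a b : ℝ, |a| ≤ b ∧ 0 < b ∧ ∀ q ∈ S, a * (α q - α p) + b * (β q - β p) ≤ 0) :
    ∀ p ∈ S, ∀ q ∈ S, |β p - β q| ≤ |α p - α q| := by
  have key : ∀ p ∈ S, ∀ q ∈ S, β q - β p ≤ |α p - α q| := by
    intro p hp q hq
    obtain ⟨a, b, hab, hb, hsup⟩ := h p hp
    have h1 := hsup q hq
    have h2 : -(a * (α q - α p)) ≤ b * |α p - α q| := by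
      refine (neg_le_abs _).trans ?_
      rw [abs_mul, abs_sub_comm]
      gcongr
    by_contra hlt
    have := mul_lt_mul_of_pos_left (not_le.1 hlt) hb
    linarith
  intro p hp q hq
  rw [abs_le]
  have h1 := key p hp q hq
  have h2 := key q hq p hp
  rw [abs_sub_comm] at h2
  constructor <;> linarith

theorem exists_normal (hconv : Convex ℝ K) (hint : (interior K).Nonempty) {p : ℂ}
    (hp : p ∈ frontier K) : ∃ a b : ℝ, (a ≠ 0 ∨ b ≠ 0) ∧
      ∀ q ∈ K, a * (q.re - p.re) + b * (q.im - p.im) ≤ 0 := by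
  obtain ⟨f, hf⟩ := geometric_hahn_banach_open_point hconv.interior isOpen_interior
    (show p ∉ interior K from hp.2)
  have hform : ∀ z : ℂ, f z = f 1 * z.re + f Complex.I * z.im := by
    intro z
    have e : z = z.re • (1 : ℂ) + z.im • Complex.I := by simp [Complex.re_add_im]
    conv_lhs => rw [e]
    rw [map_add, map_smul, map_smul, smul_eq_mul, smul_eq_mul]
    ring
  refine ⟨f 1, f Complex.I, ?_, fun q hq => ?_⟩
  · by_contra h
    push Not at h
    obtain ⟨z, hz⟩ := hint
    have := hf z hz
    rw [hform z, hform p, h.1, h.2] at this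
    simp at this
  · have hq' : q ∈ closure (interior K) := by
      rw [hconv.closure_interior_eq_closure_of_nonempty_interior hint]
      exact subset_closure hq
    have hle : f q ≤ f p :=
      closure_minimal (fun z hz => (hf z hz).le) (isClosed_le f.continuous continuous_const) hq'
    rw [hform q, hform p] at hle
    linarith

/-- The boundary of a planar convex body is covered by four pieces on which one of the coordinates
is inverse Lipschitz. -/
theorem exists_cover_frontier (hK : IsCompact K) (hconv : Convex ℝ K)
    (hint : (interior K).Nonempty) : ∃ S : Fin 4 → Set ℂ, frontier K = ⋃ j, S j ∧
      ∀ j, (∀ p ∈ S j, ∀ q ∈ S j, dist p q ≤ 2 * |p.re - q.re|) ∨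
        (∀ p ∈ S j, ∀ q ∈ S j, dist p q ≤ 2 * |p.im - q.im|) := by
  have hsub : frontier K ⊆ K := hK.isClosed.frontier_subset
  -- Boundary points having an outward normal in the quarter-plane around the positive `β`
  -- direction. The four choices of axis and sign exhaust all directions.
  set P : (ℂ → ℝ) → (ℂ → ℝ) → Set ℂ := fun α β => {p ∈ frontier K | ∃ a b : ℝ, |a| ≤ b ∧ 0 < b ∧
    ∀ q ∈ K, a * (α q - α p) + b * (β q - β p) ≤ 0} with hP
  have hPs : ∀ α β, P α β ⊆ frontier K := fun α β => Set.sep_subset _ _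
  have hPabs : ∀ α β, ∀ p ∈ P α β, ∀ q ∈ P α β, |β p - β q| ≤ |α p - α q| := by
    intro α β
    apply abs_sub_le_of_normals
    rintro p ⟨-, a, b, h1, h2, h3⟩
    exact ⟨a, b, h1, h2, fun q hq => h3 q (hsub (hPs α β hq))⟩
  have hdist : ∀ p q : ℂ, dist p q ≤ |p.re - q.re| + |p.im - q.im| := by
    intro p q
    rw [dist_eq_norm]
    simpa using Complex.norm_le_abs_re_add_abs_im (p - q)
  refine ⟨![P Complex.re Complex.im, P Complex.re (fun z => -z.im), P Complex.im Complex.re,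
    P Complex.im (fun z => -z.re)], ?_, ?_⟩
  · apply Set.Subset.antisymm
    · intro p hp
      obtain ⟨a, b, hne, hab⟩ := exists_normal hconv hint hp
      have hcases : (|a| ≤ b ∧ 0 < b) ∨ (|a| ≤ -b ∧ 0 < -b) ∨ (|b| ≤ a ∧ 0 < a) ∨
          (|b| ≤ -a ∧ 0 < -a) := by
        rcases le_total |a| |b| with h | h
        · have hb : b ≠ 0 := by
            rintro rfl
            rw [abs_zero] at h
            have := abs_nonpos_iff.1 h
            simp [this] at hne
          rcases hb.lt_or_gt with hb | hb
          · rw [abs_of_neg hb] at h; exact Or.inr (Or.inl ⟨h, by linarith⟩)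
          · rw [abs_of_pos hb] at h; exact Or.inl ⟨h, hb⟩
        · have ha : a ≠ 0 := by
            rintro rfl
            rw [abs_zero] at h
            have := abs_nonpos_iff.1 h
            simp [this] at hne
          rcases ha.lt_or_gt with ha | ha
          · rw [abs_of_neg ha] at h; exact Or.inr (Or.inr (Or.inr ⟨h, by linarith⟩))
          · rw [abs_of_pos ha] at h; exact Or.inr (Or.inr (Or.inl ⟨h, ha⟩))
      rw [Set.mem_iUnion]
      rcases hcases with h | h | h | h
      · exact ⟨0, hp, a, b, h.1, h.2, hab⟩
      · exact ⟨1, hp, a, -b, h.1, h.2, fun q hq => by have := hab q hq; linarith⟩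
      · exact ⟨2, hp, b, a, h.1, h.2, fun q hq => by have := hab q hq; linarith⟩
      · exact ⟨3, hp, b, -a, h.1, h.2, fun q hq => by have := hab q hq; linarith⟩
    · refine Set.iUnion_subset fun j => ?_
      fin_cases j <;> exact hPs _ _
  · intro j
    fin_cases j
    · left; intro p hp q hq
      have := hPabs _ _ p hp q hq
      linarith [hdist p q]
    · left; intro p hp q hq
      have := hPabs _ _ p hp q hq
      rw [neg_sub_neg, abs_sub_comm] at this
      linarith [hdist p q]
    · right; intro p hp q hq
      have := hPabs _ _ p hp q hq
      linarith [hdist p q]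
    · right; intro p hp q hq
      have := hPabs _ _ p hp q hq
      rw [neg_sub_neg, abs_sub_comm] at this
      linarith [hdist p q]

theorem hausdorffMeasure_lt_top_of_dist_le {S : Set ℂ} {φ : ℂ → ℝ} (hφ : Measurable φ)
    (hS : ∀ z ∈ S, ∀ w ∈ S, dist z w ≤ 2 * |φ z - φ w|) {R : ℝ} (hR : ∀ z ∈ S, |φ z| ≤ R) :
    Measure.hausdorffMeasure 1 S < ∞ := by
  have h := map_arcLength_le hφ hS (Set.Icc (-R) R)
  rw [Measure.map_apply hφ measurableSet_Icc, arcLength,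
    Measure.restrict_apply (hφ measurableSet_Icc),
    Set.inter_eq_right.2 (show S ⊆ φ ⁻¹' Set.Icc (-R) R from fun z hz => abs_le.1 (hR z hz))] at h
  refine h.trans_lt ?_
  simp only [Measure.smul_apply, Real.volume_Icc, smul_eq_mul]
  exact ENNReal.mul_lt_top (by norm_num) ENNReal.ofReal_lt_top

theorem hausdorffMeasure_frontier_lt_top (hK : IsCompact K) (hconv : Convex ℝ K)
    (hint : (interior K).Nonempty) : Measure.hausdorffMeasure 1 (frontier K) < ∞ := by
  obtain ⟨S, hS, hSj⟩ := exists_cover_frontier hK hconv hint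
  obtain ⟨R, hR⟩ := hK.isBounded.subset_closedBall 0
  have hSR : ∀ j, ∀ z ∈ S j, ‖z‖ ≤ R := fun j z hz => mem_closedBall_zero_iff.1
    (hR (hK.isClosed.frontier_subset (hS ▸ Set.mem_iUnion_of_mem j hz)))
  rw [hS]
  refine (measure_iUnion_le _).trans_lt ?_
  rw [tsum_fintype]
  refine ENNReal.sum_lt_top.2 fun j _ => ?_
  rcases hSj j with h | h
  · exact hausdorffMeasure_lt_top_of_dist_le Complex.measurable_re h
      fun z hz => (Complex.abs_re_le_norm z).trans (hSR j z hz)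
  · exact hausdorffMeasure_lt_top_of_dist_le Complex.measurable_im h
      fun z hz => (Complex.abs_im_le_norm z).trans (hSR j z hz)

/-! ### The Carleson embedding and the estimate on horizontal lines -/

/-- The Carleson embedding for the mirror image of the boundary of a convex body. -/
theorem lintegral_reflect_sq_le (hK : IsCompact K) (hconv : Convex ℝ K)
    (hint : (interior K).Nonempty) {b β : ℝ} (hb0 : 0 ≤ b) (hb : ∀ z ∈ K, z.im ≤ b) (hβ : b < β)
    {F : ℂ → ℂ} (hF : DifferentiableOn ℂ F {z | b < z.im}) {M : ℝ}
    (hM : ∀ z : ℂ, b < z.im → ‖F z‖ ≤ M) :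
    ∫⁻ w, ‖F (reflectLine β w)‖ₑ ^ 2 ∂arcLength (frontier K) ≤
      512 * ∫⁻ x : ℝ, ‖F (x + β * Complex.I)‖ₑ ^ 2 := by
  obtain ⟨S, hS, hSj⟩ := exists_cover_frontier hK hconv hint
  have hfin := hausdorffMeasure_frontier_lt_top hK hconv hint
  have hSsub : ∀ j, S j ⊆ frontier K := fun j => hS ▸ Set.subset_iUnion S j
  have him : ∀ w ∈ frontier K, w.im ≤ b := fun w hw => hb w (hK.isClosed.frontier_subset hw)
  -- Cut off to be measurable on the whole plane; likewise `y` below is truncated so that its lower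
  -- bound `β - b` holds everywhere. Neither changes anything on the boundary.
  set g : ℂ → ℝ≥0∞ := {w : ℂ | w.im ≤ b}.piecewise (fun w => ‖F (reflectLine β w)‖ₑ) 0 with hg
  have hmaps : ∀ w : ℂ, w.im ≤ b → b < (reflectLine β w).im := by
    intro w hw; rw [reflectLine_im]; linarith
  have hgm : Measurable g := by
    refine ContinuousOn.measurable_piecewise ?_ continuousOn_const
      (measurableSet_le Complex.measurable_im measurable_const)
    exact continuous_enorm.comp_continuousOn
      (hF.continuousOn.comp (continuous_reflectLine β).continuousOn fun w hw => hmaps w hw)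
  have hgeq : ∀ w ∈ frontier K, g w = ‖F (reflectLine β w)‖ₑ := fun w hw =>
    Set.piecewise_eq_of_mem _ _ _ (him w hw)
  set y : ℂ → ℝ := fun w => max (β - w.im) (β - b) with hy
  have hym : Measurable y := (measurable_const.sub Complex.measurable_im).max measurable_const
  have hyeq : ∀ w ∈ frontier K, y w = β - w.im := fun w hw =>
    max_eq_left (by linarith [him w hw])
  have hyb : ∀ w, β - b ≤ y w := fun w => le_max_right _ _
  set f : ℝ → ℝ≥0∞ := fun x => ‖F (x + β * Complex.I)‖ₑ with hf
  have hfm : Measurable f := (continuous_enorm.comp (continuous_comp_line hF hβ)).measurable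
  -- Projections have density at most `2`, so the balayage bounds give `64 * 2` over the horizontal
  -- axis and `4 * 2` over the vertical one. Four pieces make `512`.
  have hpiece : ∀ j, ∫⁻ w, g w ^ 2 ∂arcLength (S j) ≤ 128 * ∫⁻ x, f x ^ 2 := by
    intro j
    have : IsFiniteMeasure (arcLength (S j)) := ⟨by
      rw [arcLength, Measure.restrict_apply_univ]
      exact (measure_mono (hSsub j)).trans_lt hfin⟩
    have hae : ∀ᵐ w ∂arcLength (S j), w ∈ frontier K :=
      ae_mono (Measure.restrict_mono (hSsub j) le_rfl) (ae_restrict_mem isClosed_frontier.measurableSet)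
    have hg2 : ∫⁻ w, g w ^ 2 ∂arcLength (S j) ≠ ∞ := by
      refine ne_top_of_le_ne_top ?_ (lintegral_mono_ae
        (g := fun _ => ENNReal.ofReal M ^ 2) (hae.mono fun w hw => ?_))
      · rw [lintegral_const]
        exact ENNReal.mul_ne_top (by finiteness) (measure_ne_top _ _)
      · simp only [hgeq w hw]
        gcongr
        rw [← ofReal_norm]
        exact ENNReal.ofReal_le_ofReal (hM _ (hmaps w (him w hw)))
    have hgf : ∀ᵐ w ∂arcLength (S j),
        g w ≤ ∫⁻ t, ENNReal.ofReal (poissonHalfPlane (y w) (w.re - t)) * f t := by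
      filter_upwards [hae] with w hw
      have hwb := him w hw
      have hz : β < (reflectLine β w).im := by rw [reflectLine_im]; linarith
      obtain ⟨-, hP⟩ := poisson_formula_line hb0 hβ hF hM hz
      have e : (reflectLine β w).im - β = y w := by rw [reflectLine_im, hyeq w hw]; ring
      rw [e, reflectLine_re] at hP
      rw [hgeq w hw, ← hP]
      refine (enorm_integral_le_lintegral_enorm _).trans_eq (lintegral_congr fun t => ?_)
      have hn := poissonHalfPlane_nonneg (y := y w) (by linarith [hyb w]) (w.re - t)
      rw [enorm_mul, ← ofReal_norm, Complex.norm_real, Real.norm_of_nonneg hn]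
    refine lintegral_sq_le_of_le_poisson Complex.measurable_re hym hgm hg2 hfm hgf ?_
    rcases hSj j with h | h
    · refine (lintegral_balayage_sq_le_of_map_fst Complex.measurable_re hym hgm (sub_pos.2 hβ) hyb
        (map_arcLength_le Complex.measurable_re h)).trans_eq ?_
      norm_num
    · refine (lintegral_balayage_sq_le_of_map_snd Complex.measurable_re hym hgm
        (fun w => (sub_pos.2 hβ).trans_le (hyb w)) (map_arcLength_le hym ?_)).trans ?_
      · intro p hp q hq
        rw [hyeq p (hSsub j hp), hyeq q (hSsub j hq), sub_sub_sub_cancel_left, abs_sub_comm]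
        exact h p hp q hq
      · gcongr
        norm_num
  calc ∫⁻ w, ‖F (reflectLine β w)‖ₑ ^ 2 ∂arcLength (frontier K)
      = ∫⁻ w, g w ^ 2 ∂arcLength (frontier K) := by
        refine setLIntegral_congr_fun isClosed_frontier.measurableSet fun w hw => ?_
        simp only [hgeq w hw]
    _ ≤ ∑' j, ∫⁻ w, g w ^ 2 ∂arcLength (S j) := by
        rw [arcLength, hS]
        exact lintegral_iUnion_le _ _
    _ ≤ ∑ _j : Fin 4, 128 * ∫⁻ x, f x ^ 2 := by
        rw [tsum_fintype]
        exact Finset.sum_le_sum fun j _ => hpiece j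
    _ = _ := by
        rw [Finset.sum_const, Finset.card_univ, Fintype.card_fin, nsmul_eq_mul, ← mul_assoc]
        congr 1
        norm_num

/-- Reflection, Cauchy–Schwarz and the Carleson embedding bound the square of the left side by the
right side times the left side. The left side is finite because `F` decays like `1/|z|`, so it
cancels. -/
theorem lintegral_strict_line_sq_le (hK : IsCompact K) (hconv : Convex ℝ K)
    (h0 : (0 : ℂ) ∈ interior K) {b β : ℝ} (hb : ∀ z ∈ K, z.im ≤ b) (hβ : b < β)
    {F : ℂ → ℂ} (hF : IsRegularOutside K F) :
    ∫⁻ x : ℝ, ‖F (x + β * Complex.I)‖ₑ ^ 2 ≤ 512 * ∫⁻ w, ‖F w‖ₑ ^ 2 ∂arcLength (frontier K) := by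
  have hnhds : K ∈ 𝓝 (0 : ℂ) := mem_interior_iff_mem_nhds.1 h0
  have hb0 : 0 ≤ b := by simpa using hb 0 (interior_subset h0)
  have hβ0 : 0 < β := by linarith
  have hsub := im_gt_subset_compl hb
  have hFd := hF.differentiableOn.mono hsub
  obtain ⟨r, hr, hball⟩ := Metric.mem_nhds_iff.1 hnhds
  obtain ⟨M', hM'⟩ := hF.exists_norm_mul_le hK
  have hM'K : ∀ z ∈ Kᶜ, ‖F z‖ * ‖z‖ ≤ M' := fun z hz => hM' z (subset_closure hz)
  have hM : ∀ z ∈ Kᶜ, ‖F z‖ ≤ M' / r := by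
    intro z hz
    have hrz : r ≤ ‖z‖ := by
      by_contra h
      exact hz (hball (by simpa using not_le.1 h))
    rw [le_div_iff₀ hr]
    exact (by gcongr : ‖F z‖ * r ≤ ‖F z‖ * ‖z‖).trans (hM'K z hz)
  have hline : ∀ x : ℝ, (x + β * Complex.I : ℂ) ∈ Kᶜ := fun x => hsub (by simpa using hβ)
  have hFc := continuous_comp_line hFd hβ
  have hint : Integrable fun x : ℝ => ‖F (x + β * Complex.I)‖ ^ 2 := by
    refine Integrable.mono' ((integrable_inv_sq_add_sq hβ0).const_mul (M' ^ 2))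
      (hFc.norm.pow 2).aestronglyMeasurable (ae_of_all _ fun x => ?_)
    have h := hM'K _ (hline x)
    rw [Real.norm_of_nonneg (by positivity), ← div_eq_mul_inv, le_div_iff₀ (by positivity),
      ← norm_add_mul_I_sq, ← mul_pow]
    gcongr
  have hA : ENNReal.ofReal (∫ x : ℝ, ‖F (x + β * Complex.I)‖ ^ 2) =
      ∫⁻ x : ℝ, ‖F (x + β * Complex.I)‖ₑ ^ 2 := by
    rw [ofReal_integral_eq_lintegral_ofReal hint (ae_of_all _ fun x => by positivity)]
    refine lintegral_congr fun x => ?_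
    rw [ENNReal.ofReal_pow (norm_nonneg _), ofReal_norm]
  have hlen := (hausdorffMeasure_frontier_lt_top hK hconv ⟨0, h0⟩).ne
  have hrefl := ofReal_integral_line_sq_le hK hconv hnhds hb0 hb hβ hlen hF
  rw [hA] at hrefl
  have him : ∀ w ∈ frontier K, w.im ≤ b := fun w hw => hb w (hK.isClosed.frontier_subset hw)
  have m1 : AEMeasurable (fun w => ‖F w‖ₑ) (arcLength (frontier K)) := by
    refine ContinuousOn.aemeasurable ?_ isClosed_frontier.measurableSet
    exact continuous_enorm.comp_continuousOn hF.continuousOn_frontier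
  have m2 : AEMeasurable (fun w => ‖F (reflectLine β w)‖ₑ) (arcLength (frontier K)) := by
    refine ContinuousOn.aemeasurable ?_ isClosed_frontier.measurableSet
    refine continuous_enorm.comp_continuousOn (hFd.continuousOn.comp
      (continuous_reflectLine β).continuousOn fun w hw => ?_)
    rw [Set.mem_ofPred_eq, reflectLine_im]
    linarith [him w hw]
  refine ENNReal.le_of_sq_le_mul ?_ (by rw [← hA]; exact ENNReal.ofReal_ne_top)
  calc (∫⁻ x : ℝ, ‖F (x + β * Complex.I)‖ₑ ^ 2) ^ 2
      ≤ (∫⁻ w, ‖F w‖ₑ * ‖F (reflectLine β w)‖ₑ ∂arcLength (frontier K)) ^ 2 := by gcongr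
    _ ≤ (∫⁻ w, ‖F w‖ₑ ^ 2 ∂arcLength (frontier K)) *
        ∫⁻ w, ‖F (reflectLine β w)‖ₑ ^ 2 ∂arcLength (frontier K) := lintegral_mul_sq_le m1 m2
    _ ≤ (∫⁻ w, ‖F w‖ₑ ^ 2 ∂arcLength (frontier K)) *
        (512 * ∫⁻ x : ℝ, ‖F (x + β * Complex.I)‖ₑ ^ 2) := by
        gcongr
        exact lintegral_reflect_sq_le hK hconv ⟨0, h0⟩ hb0 hb hβ hFd fun z hz => hM z (hsub hz)
    _ = _ := by ring

/-- The constant does not depend on the distance from the line to `K`, so lines descending to height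
`b` and Fatou's lemma give the touching case; `F` is continuous up to the boundary. -/
theorem lintegral_line_sq_le (hK : IsCompact K) (hconv : Convex ℝ K)
    (h0 : (0 : ℂ) ∈ interior K) {b : ℝ} (hb : ∀ z ∈ K, z.im ≤ b)
    {F : ℂ → ℂ} (hF : IsRegularOutside K F) :
    ∫⁻ x : ℝ, ‖F (x + b * Complex.I)‖ₑ ^ 2 ≤ 512 * ∫⁻ w, ‖F w‖ₑ ^ 2 ∂arcLength (frontier K) := by
  have hsub := im_gt_subset_compl hb
  set β : ℕ → ℝ := fun n => b + 1 / ((n : ℝ) + 1) with hβ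
  have hβb : ∀ n, b < β n := fun n => by
    have : 0 < 1 / ((n : ℝ) + 1) := by positivity
    simp only [hβ]; linarith
  have hβlim : Tendsto β atTop (𝓝 b) := by
    simpa only [add_zero] using (tendsto_one_div_add_atTop_nhds_zero_nat (𝕜 := ℝ)).const_add b
  have hpt : ∀ x : ℝ, Tendsto (fun n => ‖F (x + β n * Complex.I)‖ₑ ^ 2) atTop
      (𝓝 (‖F (x + b * Complex.I)‖ₑ ^ 2)) := by
    intro x
    have hz : Tendsto (fun n => (x + β n * Complex.I : ℂ)) atTop (𝓝 (x + b * Complex.I)) :=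
      (((Complex.continuous_ofReal.tendsto b).comp hβlim).mul_const Complex.I).const_add (x : ℂ)
    have hmem : ∀ n, (x + β n * Complex.I : ℂ) ∈ Kᶜ := fun n => hsub (by simpa using hβb n)
    have hcl : (x + b * Complex.I : ℂ) ∈ closure Kᶜ :=
      mem_closure_of_tendsto hz (Eventually.of_forall hmem)
    have := (hF.continuousOn _ hcl).tendsto.comp (tendsto_nhdsWithin_iff.2
      ⟨hz, Eventually.of_forall fun n => subset_closure (hmem n)⟩)
    exact ((ENNReal.continuous_pow 2).tendsto _).comp ((continuous_enorm.tendsto _).comp this)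
  calc ∫⁻ x : ℝ, ‖F (x + b * Complex.I)‖ₑ ^ 2
      = ∫⁻ x : ℝ, liminf (fun n => ‖F (x + β n * Complex.I)‖ₑ ^ 2) atTop :=
        lintegral_congr fun x => (hpt x).liminf_eq.symm
    _ ≤ liminf (fun n => ∫⁻ x : ℝ, ‖F (x + β n * Complex.I)‖ₑ ^ 2) atTop := by
        refine lintegral_liminf_le fun n => ?_
        exact ((continuous_enorm.comp (continuous_comp_line (hF.differentiableOn.mono hsub)
          (hβb n))).measurable).pow_const 2
    _ ≤ liminf (fun _ : ℕ => 512 * ∫⁻ w, ‖F w‖ₑ ^ 2 ∂arcLength (frontier K)) atTop :=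
        liminf_le_liminf (Eventually.of_forall fun n =>
          lintegral_strict_line_sq_le hK hconv h0 hb (hβb n) hF)
    _ = _ := liminf_const _

/-! ### Rigid motions and general supporting lines -/

theorem lintegral_arcLength_line (b : ℝ) (G : ℂ → ℝ≥0∞) :
    ∫⁻ w, G w ∂arcLength {w : ℂ | w.im = b} = ∫⁻ x : ℝ, G (x + b * Complex.I) := by
  have hiso : Isometry fun x : ℝ => (x + b * Complex.I : ℂ) :=
    Isometry.of_dist_eq fun x y => by
      rw [dist_add_right, Complex.isometry_ofReal.dist_eq]
  have hrange : Set.range (fun x : ℝ => (x + b * Complex.I : ℂ)) = {w : ℂ | w.im = b} := by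
    ext w
    constructor
    · rintro ⟨x, rfl⟩; simp
    · intro h
      exact ⟨w.re, by rw [← (show w.im = b from h)]; exact Complex.re_add_im w⟩
  rw [arcLength, ← hrange, ← hiso.map_hausdorffMeasure (Or.inl zero_le_one),
    hiso.isClosedEmbedding.measurableEmbedding.lintegral_map, hausdorffMeasure_real]

theorem lintegral_arcLength_isometryEquiv (e : ℂ ≃ᵢ ℂ) (S : Set ℂ) (G : ℂ → ℝ≥0∞) :
    ∫⁻ z, G (e z) ∂arcLength (e ⁻¹' S) = ∫⁻ w, G w ∂arcLength S :=
  (e.measurePreserving_hausdorffMeasure 1).setLIntegral_comp_preimage_emb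
    e.toHomeomorph.measurableEmbedding G S

theorem IsRegularOutside.comp_isometryEquiv {F : ℂ → ℂ} (hF : IsRegularOutside K F) (e : ℂ ≃ᵢ ℂ)
    (he : Differentiable ℂ e) : IsRegularOutside (e ⁻¹' K) (F ∘ e) where
  differentiableOn := hF.differentiableOn.comp he.differentiableOn fun _ hz => hz
  continuousOn := by
    refine hF.continuousOn.comp e.continuous.continuousOn fun z hz => ?_
    have h : e ⁻¹' closure Kᶜ = closure (e ⁻¹' Kᶜ) := e.toHomeomorph.preimage_closure Kᶜ
    rw [← Set.preimage_compl, ← h] at hz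
    exact hz
  tendsto_zero := hF.tendsto_zero.comp e.toHomeomorph.isClosedEmbedding.tendsto_cocompact

theorem notMem_interior_of_forall_inner_le {u z : ℂ} (hu : u ≠ 0)
    (hmax : ∀ w ∈ K, inner ℝ u w ≤ inner ℝ u z) : z ∉ interior K := by
  intro hz
  have hlim : Tendsto (fun t : ℝ => z + t • u) (𝓝[>] 0) (𝓝 z) := by
    have : Continuous fun t : ℝ => z + t • u := by fun_prop
    have h := (this.tendsto 0).mono_left (nhdsWithin_le_nhds (s := Set.Ioi 0))
    simpa using h
  obtain ⟨t, ht, ht0⟩ := ((hlim.eventually (isOpen_interior.mem_nhds hz)).and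
    self_mem_nhdsWithin).exists
  have h := hmax _ (interior_subset ht)
  rw [inner_add_right, inner_smul_right, real_inner_self_eq_norm_sq] at h
  have h1 : 0 < t := ht0
  have h2 : 0 < ‖u‖ := norm_pos_iff.2 hu
  have : 0 < t * ‖u‖ ^ 2 := by positivity
  linarith

/-- A nonzero linear functional attains its maximum over the compact set `K` at a boundary point. -/
theorem inner_le_of_forall_frontier (hK : IsCompact K) {a u : ℂ} (hu : u ≠ 0)
    (h : ∀ z ∈ frontier K, inner ℝ u z ≤ inner ℝ u a) :
    ∀ z ∈ K, inner ℝ u z ≤ inner ℝ u a := by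
  intro z hz
  obtain ⟨z₀, hz₀, hmax⟩ := hK.exists_isMaxOn ⟨z, hz⟩
    (Continuous.continuousOn (f := fun w : ℂ => inner ℝ u w) (by fun_prop))
  have hfr : z₀ ∈ frontier K := by
    rw [hK.isClosed.frontier_eq]
    exact ⟨hz₀, notMem_interior_of_forall_inner_le hu fun w hw => hmax hw⟩
  exact (hmax hz).trans (h z₀ hfr)

theorem IsRegularOutside.lintegral_supportingLine_le (hK : IsCompact K) (hconv : Convex ℝ K)
    (hint : (interior K).Nonempty) {l : Set ℂ} (hl : IsSupportingLine (frontier K) l)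
    {F : ℂ → ℂ} (hF : IsRegularOutside K F) :
    ∫⁻ w, ‖F w‖ₑ ^ 2 ∂arcLength l ≤ 512 * ∫⁻ w, ‖F w‖ₑ ^ 2 ∂arcLength (frontier K) := by
  obtain ⟨a, u, -, hu, rfl, hsup⟩ := hl
  have hsupK := inner_le_of_forall_frontier hK hu hsup
  obtain ⟨p, hp⟩ := hint
  have hu0 : 0 < ‖u‖ := norm_pos_iff.2 hu
  -- Multiplication by `c` takes `I` to the unit normal `u / ‖u‖`, so in the new coordinates the
  -- line is horizontal with `K` below it; the translation by `p` puts the origin inside `K`.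
  set c : ℂ := -Complex.I * u / ‖u‖ with hc
  have hc1 : ‖c‖ = 1 := by
    rw [hc, norm_div, norm_mul, norm_neg, Complex.norm_I, one_mul, Complex.norm_real, norm_norm,
      div_self hu0.ne']
  set e : ℂ ≃ᵢ ℂ := (rotation ⟨c, mem_sphere_zero_iff_norm.2 hc1⟩).toIsometryEquiv.trans
    (IsometryEquiv.addLeft p) with he
  have hez : ∀ z, e z = p + c * z := fun z => rfl
  have hed : Differentiable ℂ e := by
    have : (e : ℂ → ℂ) = fun z => p + c * z := funext hez
    rw [this]; fun_prop
  have hinner : ∀ z, inner ℝ u (e z) = inner ℝ u p + ‖u‖ * z.im := by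
    intro z
    rw [hez, inner_add_right]
    congr 1
    have huu : (starRingEnd ℂ) u * u = ((‖u‖ ^ 2 : ℝ) : ℂ) := by
      rw [Complex.conj_mul']; push_cast; rfl
    have huC : (‖u‖ : ℂ) ≠ 0 := by exact_mod_cast hu0.ne'
    have e1 : c * z * (starRingEnd ℂ) u = ((‖u‖ : ℝ) : ℂ) * (-Complex.I * z) := by
      calc c * z * (starRingEnd ℂ) u = ((starRingEnd ℂ) u * u) * (-Complex.I * z) / ‖u‖ := by
            rw [hc]; ring
        _ = _ := by rw [huu]; push_cast; field_simp
    rw [Complex.inner, e1, Complex.re_ofReal_mul]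
    simp
  set b : ℝ := (inner ℝ u a - inner ℝ u p) / ‖u‖ with hb
  have hub : ‖u‖ * b = inner ℝ u a - inner ℝ u p := by rw [hb]; field_simp
  have hline : e ⁻¹' {w | inner ℝ u w = inner ℝ u a} = {z : ℂ | z.im = b} := by
    ext z
    simp only [Set.mem_preimage, Set.mem_ofPred_eq, hinner]
    constructor
    · intro h
      exact mul_left_cancel₀ hu0.ne' (by linarith)
    · intro h
      rw [h]
      linarith
  have hfr : e ⁻¹' frontier K = frontier (e ⁻¹' K) := e.toHomeomorph.preimage_frontier K
  have hK' : IsCompact (e ⁻¹' K) := e.toHomeomorph.isCompact_preimage.2 hK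
  have hconv' : Convex ℝ (e ⁻¹' K) := by
    intro x hx y hy s t hs ht hst
    have := hconv hx hy hs ht hst
    rw [Set.mem_preimage]
    convert this using 1
    simp only [hez, Complex.real_smul]
    have hstC : (s : ℂ) + t = 1 := by exact_mod_cast hst
    linear_combination (-p) * hstC
  have h0 : (0 : ℂ) ∈ interior (e ⁻¹' K) := by
    have : e ⁻¹' interior K = interior (e ⁻¹' K) := e.toHomeomorph.preimage_interior K
    rw [← this, Set.mem_preimage, hez, mul_zero, add_zero]
    exact hp
  have hbK : ∀ z ∈ e ⁻¹' K, z.im ≤ b := by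
    intro z hz
    have := hsupK _ hz
    rw [hinner] at this
    exact le_of_mul_le_mul_left (by linarith) hu0
  have key := lintegral_line_sq_le hK' hconv' h0 hbK (hF.comp_isometryEquiv e hed)
  rw [← lintegral_arcLength_line b fun w => ‖(F ∘ e) w‖ₑ ^ 2, ← hline, ← hfr] at key
  have e1 := lintegral_arcLength_isometryEquiv e {w | inner ℝ u w = inner ℝ u a}
    fun w => ‖F w‖ₑ ^ 2
  have e2 := lintegral_arcLength_isometryEquiv e (frontier K) fun w => ‖F w‖ₑ ^ 2
  rw [← e1, ← e2]
  exact key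

end Pieces

/-! ### Passage to the Smirnov space -/

theorem eLpNorm_two_sq {α : Type*} [MeasurableSpace α] (μ : Measure α) (f : α → ℂ) :
    eLpNorm f 2 μ ^ 2 = ∫⁻ x, ‖f x‖ₑ ^ 2 ∂μ := by
  have := eLpNorm_nnreal_pow_eq_lintegral (μ := μ) (f := f) (p := 2) (by norm_num)
  simpa using this

theorem lemma1 (K : Set ℂ) (hK : IsCompact K) (hconv : Convex ℝ K) (hint : (interior K).Nonempty) :
    ∃ C : ℝ≥0, ∀ l : Set ℂ, IsSupportingLine (frontier K) l →
      ∀ f : ℂ → ℂ, MemSmirnovTwo K f →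
        ∫⁻ w, ‖f w‖ₑ ^ 2 ∂(arcLength l) ≤ C * ∫⁻ w, ‖f w‖ₑ ^ 2 ∂(arcLength (frontier K)) := by
  -- `512` for the part of the line outside `K`, plus `1` for the part on `Γ`.
  refine ⟨513, fun l hl f hf => ?_⟩
  obtain ⟨F, hF, hL2, hloc⟩ := hf.exists_approx
  set Γ := frontier K
  have hbound : ∀ n, ∫⁻ w, ‖F n w‖ₑ ^ 2 ∂arcLength l ≤
      512 * (eLpNorm (F n - f) 2 (arcLength Γ) + eLpNorm f 2 (arcLength Γ)) ^ 2 := by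
    intro n
    refine ((hF n).lintegral_supportingLine_le hK hconv hint hl).trans ?_
    rw [← eLpNorm_two_sq]
    gcongr
    have hFm : AEStronglyMeasurable (F n) (arcLength Γ) := by
      exact (hF n).continuousOn_frontier.aestronglyMeasurable isClosed_frontier.measurableSet
    have := eLpNorm_add_le (hFm.sub hf.memLp.1) hf.memLp.1 one_le_two
    rwa [sub_add_cancel] at this
  have hlim : Tendsto (fun n =>
      512 * (eLpNorm (F n - f) 2 (arcLength Γ) + eLpNorm f 2 (arcLength Γ)) ^ 2) atTop
      (𝓝 (512 * (0 + eLpNorm f 2 (arcLength Γ)) ^ 2)) := by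
    refine ENNReal.Tendsto.const_mul ?_ (Or.inr (by norm_num))
    exact ((ENNReal.continuous_pow 2).tendsto _).comp (hL2.add tendsto_const_nhds)
  obtain ⟨a, u, -, hu, rfl, hsup⟩ := id hl
  set l : Set ℂ := {w | inner ℝ u w = inner ℝ u a} with hldef
  have hsupK := inner_le_of_forall_frontier hK hu hsup
  have hlclosed : IsClosed l := isClosed_eq (by fun_prop) continuous_const
  have hmeas : MeasurableSet (l ∩ Kᶜ) :=
    hlclosed.measurableSet.inter hK.isClosed.isOpen_compl.measurableSet
  -- Off `K` the approximants converge pointwise, so Fatou's lemma applies, and their norms on `Γ`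
  -- converge to that of `f`.
  have hout : ∫⁻ w, ‖f w‖ₑ ^ 2 ∂arcLength (l ∩ Kᶜ) ≤ 512 * ∫⁻ w, ‖f w‖ₑ ^ 2 ∂arcLength Γ := by
    calc ∫⁻ w, ‖f w‖ₑ ^ 2 ∂arcLength (l ∩ Kᶜ)
        = ∫⁻ w, liminf (fun n => ‖F n w‖ₑ ^ 2) atTop ∂arcLength (l ∩ Kᶜ) := by
          refine setLIntegral_congr_fun hmeas fun w hw => ?_
          have := hloc.tendsto_at hw.2
          exact (((ENNReal.continuous_pow 2).tendsto _).comp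
            ((continuous_enorm.tendsto _).comp this)).liminf_eq.symm
      _ ≤ liminf (fun n => ∫⁻ w, ‖F n w‖ₑ ^ 2 ∂arcLength (l ∩ Kᶜ)) atTop := by
          refine lintegral_liminf_le' fun n => AEMeasurable.pow_const ?_ 2
          refine ContinuousOn.aemeasurable ?_ hmeas
          exact continuous_enorm.comp_continuousOn
            ((hF n).differentiableOn.continuousOn.mono Set.inter_subset_right)
      _ ≤ liminf (fun n =>
            512 * (eLpNorm (F n - f) 2 (arcLength Γ) + eLpNorm f 2 (arcLength Γ)) ^ 2) atTop :=
          liminf_le_liminf (Eventually.of_forall fun n => (lintegral_mono'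
            (Measure.restrict_mono Set.inter_subset_left le_rfl) le_rfl).trans (hbound n))
      _ = _ := by rw [hlim.liminf_eq, zero_add, eLpNorm_two_sq]
  -- The line may share a segment with `K`, where no pointwise convergence is known. That segment
  -- lies in `Γ`, so the bound there is monotonicity.
  have hin : ∫⁻ w, ‖f w‖ₑ ^ 2 ∂arcLength (l ∩ K) ≤ ∫⁻ w, ‖f w‖ₑ ^ 2 ∂arcLength Γ := by
    refine lintegral_mono' (Measure.restrict_mono ?_ le_rfl) le_rfl
    rintro w ⟨hwl, hwK⟩
    rw [show Γ = K \ interior K from hK.isClosed.frontier_eq]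
    refine ⟨hwK, notMem_interior_of_forall_inner_le hu fun z hz => ?_⟩
    rw [show inner ℝ u w = inner ℝ u a from hwl]
    exact hsupK z hz
  calc ∫⁻ w, ‖f w‖ₑ ^ 2 ∂arcLength l
      = ∫⁻ w, ‖f w‖ₑ ^ 2 ∂arcLength (l ∩ K ∪ l ∩ Kᶜ) := by
        rw [← Set.inter_union_distrib_left, Set.union_compl_self, Set.inter_univ]
    _ ≤ ∫⁻ w, ‖f w‖ₑ ^ 2 ∂arcLength (l ∩ K) + ∫⁻ w, ‖f w‖ₑ ^ 2 ∂arcLength (l ∩ Kᶜ) :=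
        lintegral_union_le _ _ _
    _ ≤ (∫⁻ w, ‖f w‖ₑ ^ 2 ∂arcLength Γ) + 512 * ∫⁻ w, ‖f w‖ₑ ^ 2 ∂arcLength Γ :=
        add_le_add hin hout
    _ = _ := by
        push_cast
        ring
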